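/- **Setting.** Consider a sequence of linear regression problems (indexed by $n$, with $p=p_n\to\infty$): $Y=X\theta+Z$, $Z\sim N_n(0,I_n)$, with $X$ a deterministic $n\times p$ matrix and $\theta\in\mathbb R^p$. Let $P_\theta,E_\theta$ denote the law of $Y$ and its expectation, $S_\theta=\{i:\theta_i\ne0\}$, $\|X\|=\max_i\|X_{\cdot i}\|_2$ and $\bar\lambda=2\|X\|\sqrt{\log p}$. *Prior.* Draw $s\sim\pi_p$ on $\{0,\dots,p\}$, then $S$ uniformly among subsets of $\{1,\dots,p\}$ of size $s$, then independently $\theta_i\sim \mathrm{Lap}(\lambda)$ (density $\tfrac\lambda2e^{-\lambda|x|}$) for $i\in S$ and $\theta_i=0$ for $i\notin S$. For constants $A_1,\dots,A_4>0$, $$A_1p^{-A_3}\pi_p(s-1)\le\pi_p(s)\le A_2p^{-A_4}\pi_p(s-1),\quad s=1,\dots,p,\qquad \lambda>0,\quad \frac{\|X\|}p\le\lambda\le2\bar\lambda .$$ Let $\Pi(\cdot|Y)$ be the posterior. *Variational posteriors.* Let $\widetilde\Pi$, $\hat Q$, $\widetilde Q$ be minimizers of $Q\mapsto \mathrm{KL}(Q\|\Pi(\cdot|Y))$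 over, respectively, $\{\bigotimes_{i=1}^p[\gamma_iN(\mu_i,\sigma_i^2)+(1-\gamma_i)\delta_0]:\mu_i\in\mathbb R,\sigma_i>0,\gamma_i\in[0,1]\}$; $\{N_S(\mu_S,\Sigma_S)\otimes\delta_{S^c}: S\subseteq\{1,\dots,p\},\ \mu_S\in\mathbb R^{S},\ \Sigma_S \text{ positive definite}\}$; and the subfamily of the latter with $\Sigma_S$ diagonal. (Any choice of minimizer for each $Y$ is allowed; where it is not measurable in $Y$, $E_{\theta_0}$ below is the upper expectation.) *Compatibility.* Set $$\phi(S)=\inf\Big\{\tfrac{\|X\theta\|_2|S|^{1/2}}{\|X\|\|\theta_S\|_1}:\|\theta_{S^c}\|_1\le7\|\theta_S\|_1,\ \theta_S\ne0\Big\},$$ $$\overline\phi(s)=\inf\Big\{\tfrac{\|X\theta\|_2|S_\theta|^{1/2}}{\|X\|\|\theta\|_1}:0\ne|S_\theta|\le s\Big\},\qquad \widetilde\phi(s)=\inf\Big\{\tfrac{\|X\theta\|_2}{\|X\|\|\theta\|_2}:0\ne|S_\theta|\le s\Big\},$$ and, for $L>0$, $\overline\psi_L(S)=\overline\phi(d_L(S))$,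 $\widetilde\psi_L(S)=\widetilde\phi(d_L(S))$ with $d_L(S)=\big(2+\tfrac{4L}{A_4}(1+\tfrac{16}{\phi(S)^2}\tfrac{\lambda}{\bar\lambda})\big)|S|$. For $c_0>0$, integers $s_n\ge1$ and $\rho_n>0$ let $$\Theta_{\rho_n,s_n}=\{\theta_0\in\mathbb R^p\setminus\{0\}:\ \phi(S_{\theta_0})\ge c_0,\ |S_{\theta_0}|\le s_n,\ \widetilde\psi_{\rho_n}(S_{\theta_0})\ge c_0\}.$$ **Theorem (Recovery).** For all $A_1,\dots,A_4>0$ there is $M>0$, depending only on $A_1,\dots,A_4$, such that the following holds. Suppose $p\to\infty$, the prior satisfies the conditions above for every $n$, $\lambda=O(\|X\|\sqrt{\log p}/s_n)$, $c_0>0$ is fixed, and $\rho_n\to\infty$ (arbitrarily slowly). Then, with $S_0=S_{\theta_0}$, $$\sup_{\theta_0\in\Theta_{\rho_n,s_n}}E_{\theta_0}\widetilde\Pi\Big(\theta:\|X(\theta-\theta_0)\|_2\ge\frac{M\rho_n^{1/2}}{\overline\psi_{\rho_n}(S_0)}\frac{\sqrt{|S_0|\log p}}{\phi(S_0)}\Big)\to0,$$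 $$\sup_{\theta_0\in\Theta_{\rho_n,s_n}}E_{\theta_0}\widetilde\Pi\Big(\theta:\|\theta-\theta_0\|_1>\frac{M\rho_n}{\overline\psi_{\rho_n}(S_0)^2}\frac{|S_0|\sqrt{\log p}}{\|X\|\phi(S_0)^2}\Big)\to0,$$ $$\sup_{\theta_0\in\Theta_{\rho_n,s_n}}E_{\theta_0}\widetilde\Pi\Big(\theta:\|\theta-\theta_0\|_2>\frac{M\rho_n^{1/2}}{\|X\|\widetilde\psi_{\rho_n}(S_0)^2}\frac{\sqrt{|S_0|\log p}}{\phi(S_0)}\Big)\to0 .$$ The same three statements hold, with the same $M$, for $\hat Q$ and for $\widetilde Q$ in place of $\widetilde\Pi$. -/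

import Mathlib

open MeasureTheory ProbabilityTheory InformationTheory Filter Topology
open scoped ENNReal NNReal Matrix

noncomputable section

namespace SparseVB

/-! ### Norms, supports, restrictions -/

/-- The Euclidean norm of a finite real vector. -/
def l2norm {ι : Type*} [Fintype ι] (v : ι → ℝ) : ℝ := √(∑ i, v i ^ 2)

/-- The `ℓ¹` norm of a finite real vector. -/
def l1norm {ι : Type*} [Fintype ι] (v : ι → ℝ) : ℝ := ∑ i, |v i|

/-- The `ℓ¹` norm of the subvector of `v` with coordinates in `S`. -/
def l1normOn {p : ℕ} (S : Finset (Fin p)) (v : Fin p → ℝ) : ℝ := ∑ i ∈ S, |v i|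

/-- The set of non-zero coordinates of `θ`. -/
def supp {p : ℕ} (θ : Fin p → ℝ) : Finset (Fin p) := Finset.univ.filter fun i => θ i ≠ 0

/-- The maximal Euclidean norm of the columns of `X`. -/
def colNorm {n p : ℕ} (X : Matrix (Fin n) (Fin p) ℝ) : ℝ := ⨆ i : Fin p, l2norm (X.col i)

/-! ### Compatibility constants of a design matrix -/

/-- The compatibility number of a model `S`. (For `S = ∅` the infimum is over the empty set; this
case is never used below.) -/
def compat {n p : ℕ} (X : Matrix (Fin n) (Fin p) ℝ) (S : Finset (Fin p)) : ℝ :=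
  sInf {r : ℝ | ∃ θ : Fin p → ℝ, l1normOn Sᶜ θ ≤ 7 * l1normOn S θ ∧ (∃ i ∈ S, θ i ≠ 0) ∧
    r = l2norm (X *ᵥ θ) * √(S.card : ℝ) / (colNorm X * l1normOn S θ)}

/-- The compatibility number for vectors of dimension at most `s`. -/
def unifCompat {n p : ℕ} (X : Matrix (Fin n) (Fin p) ℝ) (s : ℝ) : ℝ :=
  sInf {r : ℝ | ∃ θ : Fin p → ℝ, (supp θ).card ≠ 0 ∧ ((supp θ).card : ℝ) ≤ s ∧
    r = l2norm (X *ᵥ θ) * √((supp θ).card : ℝ) / (colNorm X * l1norm θ)}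

/-- The smallest scaled sparse singular value of dimension `s`. -/
def sparseSing {n p : ℕ} (X : Matrix (Fin n) (Fin p) ℝ) (s : ℝ) : ℝ :=
  sInf {r : ℝ | ∃ θ : Fin p → ℝ, (supp θ).card ≠ 0 ∧ ((supp θ).card : ℝ) ≤ s ∧
    r = l2norm (X *ᵥ θ) / (colNorm X * l2norm θ)}

/-- The usual LASSO regularization parameter `2‖X‖ √(log p)`. -/
def lamBar {n p : ℕ} (X : Matrix (Fin n) (Fin p) ℝ) : ℝ := 2 * colNorm X * √(Real.log p)

/-- The inflated dimension `(2 + (4 M / A₄) (1 + (16 / φ(S)²) (lam / lamBar))) |S|`. -/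
def inflatedDim {n p : ℕ} (X : Matrix (Fin n) (Fin p) ℝ) (lam A₄ M : ℝ) (S : Finset (Fin p)) : ℝ :=
  (2 + 4 * M / A₄ * (1 + 16 / compat X S ^ 2 * (lam / lamBar X))) * (S.card : ℝ)

/-- The number `ψ̄_M(S)`. -/
def psiBar {n p : ℕ} (X : Matrix (Fin n) (Fin p) ℝ) (lam A₄ M : ℝ) (S : Finset (Fin p)) : ℝ :=
  unifCompat X (inflatedDim X lam A₄ M S)

/-- The number `ψ̃_M(S)`. -/
def psiTilde {n p : ℕ} (X : Matrix (Fin n) (Fin p) ℝ) (lam A₄ M : ℝ) (S : Finset (Fin p)) : ℝ :=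
  sparseSing X (inflatedDim X lam A₄ M S)

/-- The class of non-zero, compatible, `s`-sparse parameters. -/
def compatSparse {n p : ℕ} (X : Matrix (Fin n) (Fin p) ℝ) (lam A₄ c₀ ρ : ℝ) (s : ℕ) :
    Set (Fin p → ℝ) :=
  {θ₀ | θ₀ ≠ 0 ∧ c₀ ≤ compat X (supp θ₀) ∧ (supp θ₀).card ≤ s ∧
    c₀ ≤ psiTilde X lam A₄ ρ (supp θ₀)}

/-! ### Model, prior, posterior -/

/-- The law `P_θ` of `Y = X θ + Z`, `Z ∼ N(0, Iₙ)`. -/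
def dataLaw {n p : ℕ} (X : Matrix (Fin n) (Fin p) ℝ) (θ : Fin p → ℝ) : Measure (Fin n → ℝ) :=
  Measure.pi fun j => gaussianReal ((X *ᵥ θ) j) 1

/-- The centered Laplace distribution with density `(lam / 2) exp (- lam |x|)`. -/
def laplace (lam : ℝ) : Measure ℝ :=
  volume.withDensity fun x => ENNReal.ofReal (lam / 2 * Real.exp (-lam * |x|))

/-- The model selection prior: a dimension `s` is drawn from the probability weights `w` on
`{0, …, p}`, then a set `S` uniformly among those of cardinality `s`, then independent Laplace
coordinates in `S`, and zeros outside `S`. -/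
def prior (p : ℕ) (w : ℕ → ℝ) (lam : ℝ) : Measure (Fin p → ℝ) :=
  ∑ S : Finset (Fin p), ENNReal.ofReal (w S.card / (p.choose S.card : ℝ)) •
    Measure.pi fun i => if i ∈ S then laplace lam else Measure.dirac 0

/-- The Gaussian likelihood of `θ`, up to the factor `(2π)^(-n/2)`, which cancels in Bayes'
formula. -/
def likelihood {n p : ℕ} (X : Matrix (Fin n) (Fin p) ℝ) (Y : Fin n → ℝ) (θ : Fin p → ℝ) : ℝ≥0∞ :=
  ENNReal.ofReal (Real.exp (-(l2norm (Y - X *ᵥ θ) ^ 2) / 2))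

/-- The posterior distribution given `Y`, by Bayes' formula. -/
def posterior {n p : ℕ} (X : Matrix (Fin n) (Fin p) ℝ) (w : ℕ → ℝ) (lam : ℝ) (Y : Fin n → ℝ) :
    Measure (Fin p → ℝ) :=
  (∫⁻ θ, likelihood X Y θ ∂(prior p w lam))⁻¹ • (prior p w lam).withDensity (likelihood X Y)

/-- The assumptions on the prior: `w` is a probability vector on `{0, …, p}` with
`A₁ p^(-A₃) w (s-1) ≤ w s ≤ A₂ p^(-A₄) w (s-1)` for `s = 1, …, p`, and
`0 < lam`, `‖X‖ / p ≤ lam ≤ 2 lamBar`. -/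
structure PriorCond {n p : ℕ} (A₁ A₂ A₃ A₄ : ℝ) (X : Matrix (Fin n) (Fin p) ℝ) (w : ℕ → ℝ)
    (lam : ℝ) : Prop where
  nonneg : ∀ s ≤ p, 0 ≤ w s
  sum_eq_one : ∑ s ∈ Finset.range (p + 1), w s = 1
  lower : ∀ s, 1 ≤ s → s ≤ p → A₁ * (p : ℝ) ^ (-A₃) * w (s - 1) ≤ w s
  upper : ∀ s, 1 ≤ s → s ≤ p → w s ≤ A₂ * (p : ℝ) ^ (-A₄) * w (s - 1)
  lam_pos : 0 < lam
  lam_lower : colNorm X / p ≤ lam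
  lam_upper : lam ≤ 2 * lamBar X

/-! ### Variational families and variational posteriors -/

/-- The mean-field spike-and-slab family: products of `γᵢ N(μᵢ, σᵢ²) + (1 - γᵢ) δ₀`. -/
def familyPMF (p : ℕ) : Set (Measure (Fin p → ℝ)) :=
  {Q | ∃ (μ : Fin p → ℝ) (σ : Fin p → ℝ≥0) (γ : Fin p → ℝ),
    (∀ i, 0 < σ i) ∧ (∀ i, γ i ∈ Set.Icc (0 : ℝ) 1) ∧
    Q = Measure.pi fun i => ENNReal.ofReal (γ i) • gaussianReal (μ i) (σ i ^ 2) +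
      ENNReal.ofReal (1 - γ i) • Measure.dirac 0}

/-- Extension by zero of a vector indexed by `S`. -/
def extendZero {p : ℕ} (S : Finset (Fin p)) (v : EuclideanSpace ℝ S) : Fin p → ℝ :=
  fun i => if h : i ∈ S then v ⟨i, h⟩ else 0

/-- The distribution `N_S(μ, Σ) ⊗ δ_{Sᶜ}` on `ℝᵖ`. -/
def gaussianOn {p : ℕ} (S : Finset (Fin p)) (μ : EuclideanSpace ℝ S) (Sig : Matrix S S ℝ) :
    Measure (Fin p → ℝ) :=
  (multivariateGaussian μ Sig).map (extendZero S)

/-- The family of all `N_S(μ, Σ) ⊗ δ_{Sᶜ}` with `Σ` positive definite. -/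
def familyQ (p : ℕ) : Set (Measure (Fin p → ℝ)) :=
  {Q | ∃ (S : Finset (Fin p)) (μ : EuclideanSpace ℝ S) (Sig : Matrix S S ℝ),
    Sig.PosDef ∧ Q = gaussianOn S μ Sig}

/-- The family of all `N_S(μ, D) ⊗ δ_{Sᶜ}` with `D` positive definite and diagonal. -/
def familyQMF (p : ℕ) : Set (Measure (Fin p → ℝ)) :=
  {Q | ∃ (S : Finset (Fin p)) (μ : EuclideanSpace ℝ S) (D : Matrix S S ℝ),
    D.PosDef ∧ D.IsDiag ∧ Q = gaussianOn S μ D}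

/-- `Q` is a variational approximation of `P` in the family `F`: a minimizer over `F` of the
Kullback-Leibler divergence `KL(· ‖ P)`. -/
def IsVB {p : ℕ} (F : Set (Measure (Fin p → ℝ))) (P Q : Measure (Fin p → ℝ)) : Prop :=
  Q ∈ F ∧ ∀ Q' ∈ F, klDiv Q P ≤ klDiv Q' P

/-! ### Expectations -/

/-- The upper expectation of `f`, i.e. the infimum of the expectations of its measurable
majorants; it is the expectation when `f` is measurable. -/
def upperExp {Ω : Type*} [MeasurableSpace Ω] (P : Measure Ω) (f : Ω → ℝ≥0∞) : ℝ≥0∞ :=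
  ⨅ (g : Ω → ℝ≥0∞) (_ : Measurable g) (_ : ∀ ω, f ω ≤ g ω), ∫⁻ ω, g ω ∂P

theorem upperExp_eq_lintegral {Ω : Type*} [MeasurableSpace Ω] (P : Measure Ω) {f : Ω → ℝ≥0∞}
    (hf : Measurable f) : upperExp P f = ∫⁻ ω, f ω ∂P :=
  le_antisymm (iInf_le_of_le f (iInf_le_of_le hf (iInf_le_of_le (fun _ => le_rfl) le_rfl)))
    (le_iInf fun _ => le_iInf fun _ => le_iInf fun h => lintegral_mono h)

/-- The worst-case expected mass over `θ₀ ∈ T` that the data-dependent distribution `Q` puts on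
the set `B θ₀`. -/
def worstMass {n p : ℕ} (X : Matrix (Fin n) (Fin p) ℝ) (T : Set (Fin p → ℝ))
    (Q : (Fin n → ℝ) → Measure (Fin p → ℝ)) (B : (Fin p → ℝ) → Set (Fin p → ℝ)) : ℝ≥0∞ :=
  ⨆ θ₀ ∈ T, upperExp (dataLaw X θ₀) fun Y => Q Y (B θ₀)

/-- The data-dependent distributions `Q k` recover the truth at the rates with constant `M`, in
prediction, `ℓ¹` and `ℓ²` loss, uniformly over the classes of compatible `s k`-sparse
parameters. -/
def Recovers {n p : ℕ → ℕ} (X : ∀ k, Matrix (Fin (n k)) (Fin (p k)) ℝ) (lam : ℕ → ℝ)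
    (A₄ c₀ : ℝ) (ρ : ℕ → ℝ) (s : ℕ → ℕ) (M : ℝ)
    (Q : ∀ k, (Fin (n k) → ℝ) → Measure (Fin (p k) → ℝ)) : Prop :=
  Tendsto (fun k => worstMass (X k) (compatSparse (X k) (lam k) A₄ c₀ (ρ k) (s k)) (Q k)
    fun θ₀ => {θ | M * √(ρ k) / psiBar (X k) (lam k) A₄ (ρ k) (supp θ₀) *
        (√((supp θ₀).card * Real.log (p k)) / compat (X k) (supp θ₀)) ≤
      l2norm (X k *ᵥ (θ - θ₀))}) atTop (𝓝 0) ∧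
  Tendsto (fun k => worstMass (X k) (compatSparse (X k) (lam k) A₄ c₀ (ρ k) (s k)) (Q k)
    fun θ₀ => {θ | M * ρ k / psiBar (X k) (lam k) A₄ (ρ k) (supp θ₀) ^ 2 *
        ((supp θ₀).card * √(Real.log (p k)) / (colNorm (X k) * compat (X k) (supp θ₀) ^ 2)) <
      l1norm (θ - θ₀)}) atTop (𝓝 0) ∧
  Tendsto (fun k => worstMass (X k) (compatSparse (X k) (lam k) A₄ c₀ (ρ k) (s k)) (Q k)
    fun θ₀ => {θ | M * √(ρ k) / (colNorm (X k) * psiTilde (X k) (lam k) A₄ (ρ k) (supp θ₀) ^ 2) *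
        (√((supp θ₀).card * Real.log (p k)) / compat (X k) (supp θ₀)) <
      l2norm (θ - θ₀)}) atTop (𝓝 0)

end SparseVB

end

/-!
The competitor `oracle θ₀ σ`, a Gaussian distribution centered at the true parameter with
covariance `‖X‖⁻² I` on the true support, belongs to all three variational families and does not
depend on the data. Hence a variational posterior `Q` satisfies
`KL(Q ‖ Π(· | Y)) ≤ KL(oracle ‖ Π(· | Y))`, and it suffices to show that the right
side is `O(|S₀| log p)` with high probability, while the posterior gives mass at most
`exp (-(ρ - C) |S₀| log p)` to the parameters outside the
asserted balls. The Donsker-Varadhan inequality (`measureReal_mul_le_of_klDiv_le`) then bounds the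
mass under `Q` by the quotient of the two exponents, which is `O(1 / ρ)`.

The posterior is the prior tilted by `excess`, the log-likelihood ratio with respect to `θ₀` plus
`lam ‖θ₀‖₁`. The divergence of the competitor equals its divergence from the prior, minus the
expectation of `excess`, plus the logarithm of the normalizing integral `I(Y)` of `exp excess`
(`klDiv_oracle_posterior_le`). The penalty `lam ‖θ₀‖₁`, which can be arbitrarily large, cancels,
so that the divergence is at most `C |S₀| log p + log I(Y)`. As a divergence is nonnegative, this
also gives `I(Y) ≥ exp (-C |S₀| log p)`.

For upper bounds on integrals of `exp excess`, let the noise have correlation at most `lamBar`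
with the columns of `X`. On this event, a fraction `lam / (2 lamBar)` of the noise term is paid
for by half of the prior penalty, and the rest has a Gaussian exponential moment which leaves a
negative multiple of `‖X (θ - θ₀)‖²`. With the compatibility number of the support (`penalty_le`)
the expectation of `exp excess` is at most `exp (lam ‖θ‖₁ - (lam / 4) ‖θ - θ₀‖₁)` times `p` to a
power of order `|S₀|`. Integrated over a slab prior of dimension `s`, this weight gives at most
`4 ^ s`, and the exponentially decreasing weights of the prior on the dimension make the sum over
`s ≥ R` small (`lintegral_numer_le`). Markov's inequality bounds `I(Y)` and the posterior mass of
models of dimension of order `ρ |S₀|`. Parameters of smaller dimension with a large prediction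
error have a small likelihood ratio, by the compatibility number for sparse vectors
(`Regular.excess_le`). Outside the resulting bad set, the compatibility numbers convert the bound
on the prediction error into bounds on the other two losses (`Regular.losses_le`).
-/

namespace SparseVB

variable {n p : ℕ} {X : Matrix (Fin n) (Fin p) ℝ}

/-! ### Norms, supports and compatibility constants -/

lemma l2norm_nonneg {ι : Type*} [Fintype ι] (v : ι → ℝ) : 0 ≤ l2norm v := Real.sqrt_nonneg _

lemma l2norm_sq {ι : Type*} [Fintype ι] (v : ι → ℝ) : l2norm v ^ 2 = ∑ i, v i ^ 2 :=
  Real.sq_sqrt (Finset.sum_nonneg fun _ _ => sq_nonneg _)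

lemma l2norm_sq_eq_dotProduct {ι : Type*} [Fintype ι] (v : ι → ℝ) : l2norm v ^ 2 = v ⬝ᵥ v := by
  rw [l2norm_sq]; simp [dotProduct, sq]

lemma l1norm_nonneg {ι : Type*} [Fintype ι] (v : ι → ℝ) : 0 ≤ l1norm v :=
  Finset.sum_nonneg fun _ _ => abs_nonneg _

lemma l1normOn_nonneg (S : Finset (Fin p)) (v : Fin p → ℝ) : 0 ≤ l1normOn S v :=
  Finset.sum_nonneg fun _ _ => abs_nonneg _

lemma l1norm_eq_add (S : Finset (Fin p)) (v : Fin p → ℝ) :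
    l1norm v = l1normOn S v + l1normOn Sᶜ v :=
  (Finset.sum_add_sum_compl S _).symm

lemma mem_supp {θ : Fin p → ℝ} {i : Fin p} : i ∈ supp θ ↔ θ i ≠ 0 := by simp [supp]

lemma supp_eq_empty_iff {θ : Fin p → ℝ} : supp θ = ∅ ↔ θ = 0 := by
  simp [supp, Finset.filter_eq_empty_iff, funext_iff]

lemma card_supp_sub_le (θ θ₀ : Fin p → ℝ) :
    (supp (θ - θ₀)).card ≤ (supp θ).card + (supp θ₀).card := by
  refine (Finset.card_le_card fun i hi => ?_).trans (Finset.card_union_le _ _)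
  by_contra h
  simp only [Finset.mem_union, mem_supp, not_or, not_not] at h
  exact mem_supp.1 hi (by simp [h.1, h.2])

lemma l1norm_pos {θ : Fin p → ℝ} (h : (supp θ).card ≠ 0) : 0 < l1norm θ := by
  obtain ⟨i, hi⟩ := Finset.card_ne_zero.1 h
  exact Finset.sum_pos' (fun _ _ => abs_nonneg _) ⟨i, Finset.mem_univ _, abs_pos.2 (mem_supp.1 hi)⟩

lemma l2norm_pos {θ : Fin p → ℝ} (h : (supp θ).card ≠ 0) : 0 < l2norm θ := by
  obtain ⟨i, hi⟩ := Finset.card_ne_zero.1 h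
  exact Real.sqrt_pos.2 (Finset.sum_pos' (fun _ _ => sq_nonneg _)
    ⟨i, Finset.mem_univ _, by have := mem_supp.1 hi; positivity⟩)

lemma l2norm_of_supp_card_eq_zero {θ : Fin p → ℝ} (h : (supp θ).card = 0) :
    l2norm θ = 0 ∧ l1norm θ = 0 := by
  rw [Finset.card_eq_zero, supp_eq_empty_iff] at h
  simp [h, l2norm, l1norm]

lemma l1norm_le_sqrt_card_mul_l2norm (θ : Fin p → ℝ) :
    l1norm θ ≤ √((supp θ).card : ℝ) * l2norm θ := by
  have h1 : l1norm θ = ∑ i ∈ supp θ, |θ i| := by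
    refine (Finset.sum_subset (Finset.subset_univ _) fun i _ hi => ?_).symm
    simpa [mem_supp] using hi
  rw [h1, l2norm, ← Real.sqrt_mul (by positivity)]
  refine Real.le_sqrt_of_sq_le ((sq_sum_le_card_mul_sum_sq).trans ?_)
  gcongr
  simp only [sq_abs]
  exact Finset.sum_le_univ_sum_of_nonneg fun _ => sq_nonneg _

lemma l2norm_col_le (X : Matrix (Fin n) (Fin p) ℝ) (i : Fin p) : l2norm (X.col i) ≤ colNorm X :=
  le_ciSup (f := fun i => l2norm (X.col i)) (Set.finite_range _).bddAbove i

lemma colNorm_nonneg (X : Matrix (Fin n) (Fin p) ℝ) : 0 ≤ colNorm X :=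
  Real.iSup_nonneg fun _ => l2norm_nonneg _

/-- `⟨z, X h⟩ = ⟨Xᵀ z, h⟩` is at most `t ‖h‖₁` if all inner products of `z` with columns of `X` are
at most `t` in absolute value. -/
lemma dotProduct_mulVec_le {z : Fin n → ℝ} {t : ℝ} (hz : ∀ i, |X.col i ⬝ᵥ z| ≤ t)
    (h : Fin p → ℝ) : z ⬝ᵥ (X *ᵥ h) ≤ t * l1norm h := by
  rw [Matrix.dotProduct_mulVec, l1norm, Finset.mul_sum]
  refine Finset.sum_le_sum fun i _ => ?_
  have : (z ᵥ* X) i = X.col i ⬝ᵥ z := by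
    simp [Matrix.vecMul, dotProduct, Matrix.col, mul_comm]
  rw [this]
  refine (le_abs_self _).trans ?_
  rw [abs_mul]
  exact mul_le_mul_of_nonneg_right (hz i) (abs_nonneg _)

lemma compat_le {S : Finset (Fin p)} {θ : Fin p → ℝ} (h1 : l1normOn Sᶜ θ ≤ 7 * l1normOn S θ)
    (h2 : ∃ i ∈ S, θ i ≠ 0) :
    compat X S ≤ l2norm (X *ᵥ θ) * √(S.card : ℝ) / (colNorm X * l1normOn S θ) := by
  refine csInf_le ⟨0, ?_⟩ ⟨θ, h1, h2, rfl⟩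
  rintro r ⟨θ, -, -, rfl⟩
  have := colNorm_nonneg X
  have := l1normOn_nonneg S θ
  have := l2norm_nonneg (X *ᵥ θ)
  positivity

lemma unifCompat_le {s : ℝ} {θ : Fin p → ℝ} (h1 : (supp θ).card ≠ 0)
    (h2 : ((supp θ).card : ℝ) ≤ s) :
    unifCompat X s ≤ l2norm (X *ᵥ θ) * √((supp θ).card : ℝ) / (colNorm X * l1norm θ) := by
  refine csInf_le ⟨0, ?_⟩ ⟨θ, h1, h2, rfl⟩
  rintro r ⟨θ, -, -, rfl⟩
  have := colNorm_nonneg X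
  have := l1norm_nonneg θ
  have := l2norm_nonneg (X *ᵥ θ)
  positivity

lemma sparseSing_le {s : ℝ} {θ : Fin p → ℝ} (h1 : (supp θ).card ≠ 0)
    (h2 : ((supp θ).card : ℝ) ≤ s) :
    sparseSing X s ≤ l2norm (X *ᵥ θ) / (colNorm X * l2norm θ) := by
  refine csInf_le ⟨0, ?_⟩ ⟨θ, h1, h2, rfl⟩
  rintro r ⟨θ, -, -, rfl⟩
  have := colNorm_nonneg X
  have := l2norm_nonneg θ
  have := l2norm_nonneg (X *ᵥ θ)
  positivity

/-- A choice of signs on `S` for which the corresponding combination of columns is as short as for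
orthogonal columns: the sign of each new column is chosen to make the cross term nonpositive. -/
lemma exists_signs (X : Matrix (Fin n) (Fin p) ℝ) (S : Finset (Fin p)) :
    ∃ ε : Fin p → ℝ, (∀ i ∈ S, |ε i| = 1) ∧ (∀ i ∉ S, ε i = 0) ∧
      l2norm (X *ᵥ ε) ^ 2 ≤ S.card * colNorm X ^ 2 := by
  induction S using Finset.induction_on with
  | empty => exact ⟨0, by simp, by simp, by simp [l2norm]⟩
  | insert a S ha ih =>
    obtain ⟨ε, h1, h0, hε⟩ := ih
    obtain ⟨t, ht1, ht⟩ : ∃ t : ℝ, |t| = 1 ∧ t * (X.col a ⬝ᵥ (X *ᵥ ε)) ≤ 0 := by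
      rcases le_total (X.col a ⬝ᵥ (X *ᵥ ε)) 0 with h | h
      · exact ⟨1, by simp, by simpa using h⟩
      · exact ⟨-1, by simp, by simpa using h⟩
    refine ⟨ε + Pi.single a t, fun i hi => ?_, fun i hi => ?_, ?_⟩
    · rcases Finset.mem_insert.1 hi with rfl | hi'
      · simp [h0 _ ha, ht1]
      · have : i ≠ a := by rintro rfl; exact ha hi'
        simp [this, h1 i hi']
    · rw [Finset.mem_insert, not_or] at hi
      simp [hi.1, h0 i hi.2]
    · have e1 : X *ᵥ (ε + Pi.single a t) = X *ᵥ ε + t • X.col a := by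
        rw [Matrix.mulVec_add, Matrix.mulVec_single, op_smul_eq_smul]
      have e2 : l2norm (X.col a) ^ 2 ≤ colNorm X ^ 2 :=
        pow_le_pow_left₀ (l2norm_nonneg _) (l2norm_col_le X a) 2
      have e3 : t * t = 1 := by rw [← abs_mul_abs_self, ht1, one_mul]
      rw [l2norm_sq_eq_dotProduct] at hε e2 ⊢
      rw [e1, add_dotProduct, dotProduct_add, dotProduct_add, smul_dotProduct, dotProduct_smul,
        smul_dotProduct, dotProduct_smul, dotProduct_comm (X *ᵥ ε) (X.col a),
        Finset.card_insert_of_notMem ha]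
      simp only [smul_eq_mul, ← mul_assoc, e3]
      push_cast
      linarith

/-- For some choice of signs on `S` the prediction norm is at most `‖X‖ √|S|`. -/
lemma compat_le_one (hX : 0 < colNorm X) {S : Finset (Fin p)} (hS : S.Nonempty) :
    compat X S ≤ 1 := by
  obtain ⟨ε, h1, h0, hε⟩ := exists_signs X S
  have hc : l1normOn Sᶜ ε = 0 := Finset.sum_eq_zero fun i hi => by
    simp [h0 i (Finset.mem_compl.1 hi)]
  have hs : l1normOn S ε = S.card := by
    rw [l1normOn, Finset.sum_congr rfl h1]; simp
  obtain ⟨i, hi⟩ := hS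
  have hpos : (0 : ℝ) < S.card := by exact_mod_cast Finset.card_pos.2 ⟨i, hi⟩
  refine (compat_le (θ := ε) (by rw [hc, hs]; positivity)
    ⟨i, hi, fun h => by simpa [h] using h1 i hi⟩).trans ?_
  rw [hs, div_le_one (by positivity)]
  have h2 : l2norm (X *ᵥ ε) ≤ √(S.card : ℝ) * colNorm X := by
    refine le_of_sq_le_sq ?_ (by positivity)
    rwa [mul_pow, Real.sq_sqrt hpos.le]
  calc l2norm (X *ᵥ ε) * √(S.card : ℝ) ≤ √(S.card : ℝ) * colNorm X * √(S.card : ℝ) := by gcongr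
    _ = colNorm X * S.card := by
      rw [mul_right_comm, Real.mul_self_sqrt hpos.le, mul_comm]

lemma unifCompat_le_one (hX : 0 < colNorm X) (i : Fin p) {s : ℝ} (hs : 1 ≤ s) :
    unifCompat X s ≤ 1 := by
  have e : supp (Pi.single i (1 : ℝ)) = {i} := by
    ext j; simp [mem_supp, Pi.single_apply]
  refine (unifCompat_le (θ := Pi.single i 1) (by simp [e]) (by simpa [e] using hs)).trans ?_
  have h1 : l1norm (Pi.single i (1 : ℝ)) = 1 := by
    simp [l1norm, Pi.single_apply, apply_ite abs]
  have h2 := l2norm_col_le X i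
  rw [h1, e]
  simpa [div_le_one hX] using h2

lemma sparseSing_le_unifCompat (hX : 0 < colNorm X) (i : Fin p) {s : ℝ} (hs : 1 ≤ s) :
    sparseSing X s ≤ unifCompat X s := by
  have e : supp (Pi.single i (1 : ℝ)) = {i} := by
    ext j; simp [mem_supp, Pi.single_apply]
  refine le_csInf ⟨_, Pi.single i 1, by simp [e], by simpa [e] using hs, rfl⟩ ?_
  rintro r ⟨θ, h1, h2, rfl⟩
  refine (sparseSing_le h1 h2).trans ?_
  have hl1 := l1norm_pos h1
  have hl2 := l2norm_pos h1
  rw [div_le_div_iff₀ (by positivity) (by positivity)]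
  have h3 := mul_le_mul_of_nonneg_left (l1norm_le_sqrt_card_mul_l2norm θ)
    (mul_nonneg (l2norm_nonneg (X *ᵥ θ)) hX.le)
  linarith

/-- The `ℓ¹` norm of a sparse vector is controlled by its prediction norm. -/
lemma l1norm_le_of_unifCompat (hX : 0 < colNorm X) {s : ℝ} (hψ : 0 < unifCompat X s)
    {h : Fin p → ℝ} (hs : ((supp h).card : ℝ) ≤ s) :
    l1norm h ≤ l2norm (X *ᵥ h) * √s / (colNorm X * unifCompat X s) := by
  by_cases h0 : (supp h).card = 0
  · rw [(l2norm_of_supp_card_eq_zero h0).2]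
    have := l2norm_nonneg (X *ᵥ h)
    positivity
  · have h1 := l1norm_pos h0
    have h2 := unifCompat_le (X := X) h0 hs
    rw [le_div_iff₀ (by positivity)] at h2 ⊢
    have h3 : l2norm (X *ᵥ h) * √((supp h).card : ℝ) ≤ l2norm (X *ᵥ h) * √s :=
      mul_le_mul_of_nonneg_left (Real.sqrt_le_sqrt hs) (l2norm_nonneg _)
    linarith

/-- The Euclidean norm of a sparse vector is controlled by its prediction norm. -/
lemma l2norm_le_of_sparseSing (hX : 0 < colNorm X) {s : ℝ} (hψ : 0 < sparseSing X s)
    {h : Fin p → ℝ} (hs : ((supp h).card : ℝ) ≤ s) :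
    l2norm h ≤ l2norm (X *ᵥ h) / (colNorm X * sparseSing X s) := by
  by_cases h0 : (supp h).card = 0
  · rw [(l2norm_of_supp_card_eq_zero h0).1]
    have := l2norm_nonneg (X *ᵥ h)
    positivity
  · have h1 := l2norm_pos h0
    have h2 := sparseSing_le (X := X) h0 hs
    rw [le_div_iff₀ (by positivity)] at h2 ⊢
    linarith

/-- The `ℓ¹` norm decreases at most by the deviation on the support of `θ₀`, and increases by the
mass outside it. -/
lemma l1norm_sub_le (θ₀ θ : Fin p → ℝ) :
    l1norm θ₀ - l1norm θ ≤
      l1normOn (supp θ₀) (θ - θ₀) - l1normOn (supp θ₀)ᶜ (θ - θ₀) := by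
  rw [l1norm_eq_add (supp θ₀) θ₀, l1norm_eq_add (supp θ₀) θ]
  have h1 : l1normOn (supp θ₀)ᶜ θ₀ = 0 := Finset.sum_eq_zero fun i hi => by
    simpa [mem_supp] using hi
  have h2 : l1normOn (supp θ₀)ᶜ (θ - θ₀) = l1normOn (supp θ₀)ᶜ θ :=
    Finset.sum_congr rfl fun i hi => by
      have : θ₀ i = 0 := by simpa [mem_supp] using hi
      simp [this]
  have h3 : l1normOn (supp θ₀) θ₀ - l1normOn (supp θ₀) θ ≤ l1normOn (supp θ₀) (θ - θ₀) := by
    simp only [l1normOn, ← Finset.sum_sub_distrib]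
    refine Finset.sum_le_sum fun i _ => ?_
    rw [Pi.sub_apply, abs_sub_comm]
    exact abs_sub_abs_le_abs_sub _ _
  rw [h1, h2]; linarith

lemma l1norm_sub_l1norm_le (θ₀ θ : Fin p → ℝ) : l1norm θ₀ - l1norm θ ≤ l1norm (θ - θ₀) := by
  have h1 := l1norm_sub_le θ₀ θ
  have h2 := l1norm_eq_add (supp θ₀) (θ - θ₀)
  have h3 := l1normOn_nonneg (supp θ₀)ᶜ (θ - θ₀)
  linarith

/-- Half of the prior penalty, together with a fraction of the quadratic form, already dominates
a multiple of the `ℓ¹` distance to `θ₀`, up to a compatibility term. This is where the cone with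
constant `7` in the definition of the compatibility number enters. -/
lemma penalty_le {lam lb : ℝ} (hX : 0 < colNorm X) (hlam : 0 < lam) (hlb : 0 < lb)
    {θ₀ : Fin p → ℝ} (hφ : 0 < compat X (supp θ₀)) (θ : Fin p → ℝ) :
    lam * (l1norm θ₀ - l1norm θ) + lam / 2 * l1norm (θ - θ₀)
        - lam / (4 * lb) * l2norm (X *ᵥ (θ - θ₀)) ^ 2 ≤
      -(lam / 4) * l1norm (θ - θ₀)
        + 49 / 16 * (lam * lb * (supp θ₀).card / (colNorm X ^ 2 * compat X (supp θ₀) ^ 2)) := by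
  set h := θ - θ₀
  set S := supp θ₀
  set a := l1normOn S h
  set b := l1normOn Sᶜ h
  have h1 : l1norm θ₀ - l1norm θ ≤ a - b := l1norm_sub_le θ₀ θ
  have h2 : l1norm h = a + b := l1norm_eq_add S h
  have ha : 0 ≤ a := l1normOn_nonneg _ _
  have hb : 0 ≤ b := l1normOn_nonneg _ _
  have hN := l2norm_nonneg (X *ᵥ h)
  set N := l2norm (X *ᵥ h)
  set φ := compat X S
  set c := colNorm X
  have key : lam * (7 / 4 * a - b / 4) - lam / (4 * lb) * N ^ 2 ≤
      49 / 16 * (lam * lb * S.card / (c ^ 2 * φ ^ 2)) := by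
    by_cases hab : b ≤ 7 * a ∧ 0 < a
    · have hc : φ ≤ N * √(S.card : ℝ) / (c * a) := by
        refine compat_le hab.1 ?_
        by_contra hcon
        push Not at hcon
        have : a = 0 := Finset.sum_eq_zero fun i hi => by simp [hcon i hi]
        linarith [hab.2]
      have hapos := hab.2
      have ha' : a ≤ N * √(S.card : ℝ) / (c * φ) := by
        rw [le_div_iff₀ (by positivity)] at hc ⊢
        linarith
      set t := √(S.card : ℝ) / (c * φ)
      have ht : t ^ 2 = S.card / (c ^ 2 * φ ^ 2) := by
        rw [div_pow, Real.sq_sqrt (by positivity), mul_pow]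
      have ha'' : a ≤ N * t := by rwa [mul_div_assoc] at ha'
      have e : lam * lb * S.card / (c ^ 2 * φ ^ 2) = lam * lb * t ^ 2 := by
        rw [ht, mul_div_assoc]
      rw [e]
      -- the minimum of the quadratic function of `N` is at `7 / 2 * lb * t`
      have hsq : 0 ≤ lam / (4 * lb) * (N - 7 / 2 * lb * t) ^ 2 := by positivity
      have e2 : lam / (4 * lb) * (N - 7 / 2 * lb * t) ^ 2 =
          lam / (4 * lb) * N ^ 2 - lam * (7 / 4 * (N * t)) + 49 / 16 * (lam * lb * t ^ 2) := by
        field_simp; ring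
      have : lam * (7 / 4 * a - b / 4) ≤ lam * (7 / 4 * (N * t)) := by gcongr; linarith
      linarith
    · have : 7 / 4 * a - b / 4 ≤ 0 := by
        by_cases h7 : b ≤ 7 * a
        · have : a ≤ 0 := by by_contra h'; exact hab ⟨h7, not_le.1 h'⟩
          linarith
        · linarith
      have h3 : lam * (7 / 4 * a - b / 4) ≤ 0 := mul_nonpos_of_nonneg_of_nonpos hlam.le this
      have h4 : 0 ≤ lam / (4 * lb) * N ^ 2 := by positivity
      have h5 : 0 ≤ 49 / 16 * (lam * lb * S.card / (c ^ 2 * φ ^ 2)) := by positivity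
      linarith
  rw [h2]
  have := mul_le_mul_of_nonneg_left h1 hlam.le
  nlinarith

/-- On vectors with sparse deviation from `θ₀`, a large multiple of the `ℓ¹` distance is dominated
by the quadratic form, up to a compatibility term. -/
lemma l1norm_le_quadratic {lb s : ℝ} (hX : 0 < colNorm X)
    (hψ : 0 < unifCompat X s) {h : Fin p → ℝ} (hs : ((supp h).card : ℝ) ≤ s) (hlb : 0 ≤ lb) :
    7 / 2 * lb * l1norm h - l2norm (X *ᵥ h) ^ 2 / 2 ≤
      -(l2norm (X *ᵥ h) ^ 2 / 4) +
        49 / 4 * (lb ^ 2 * s / (colNorm X ^ 2 * unifCompat X s ^ 2)) := by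
  have h1 := l1norm_le_of_unifCompat hX hψ hs
  have hs0 : 0 ≤ s := (Nat.cast_nonneg _).trans hs
  set N := l2norm (X *ᵥ h)
  set t := √s / (colNorm X * unifCompat X s)
  have ht : t ^ 2 = s / (colNorm X ^ 2 * unifCompat X s ^ 2) := by
    rw [div_pow, Real.sq_sqrt hs0, mul_pow]
  have h2 : l1norm h ≤ N * t := by rwa [mul_div_assoc] at h1
  have h3 : 7 / 2 * lb * l1norm h ≤ 7 / 2 * lb * (N * t) := by gcongr
  rw [mul_div_assoc, ← ht]
  nlinarith [sq_nonneg (N / 2 - 7 / 2 * lb * t)]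

/-! ### Product measures and Gaussian noise -/

lemma lintegral_pi_prod {ι : Type*} [Fintype ι] {Ω : ι → Type*} [∀ i, MeasurableSpace (Ω i)]
    (μ : ∀ i, Measure (Ω i)) [∀ i, IsProbabilityMeasure (μ i)] {f : ∀ i, Ω i → ℝ≥0∞}
    (hf : ∀ i, Measurable (f i)) :
    ∫⁻ x, ∏ i, f i (x i) ∂(Measure.pi μ) = ∏ i, ∫⁻ x, f i x ∂(μ i) := by
  have h := lintegral_prod_eq_prod_lintegral_of_indepFun (μ := Measure.pi μ) Finset.univ
    (fun i x => f i (x i)) (iIndepFun_pi fun i => (hf i).aemeasurable)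
    fun i => (hf i).comp (measurable_pi_apply i)
  rw [h]
  refine Finset.prod_congr rfl fun i _ => ?_
  exact (measurePreserving_eval μ i).lintegral_comp (hf i)

lemma pi_withDensity {ι : Type*} [Fintype ι] {Ω : ι → Type*} [∀ i, MeasurableSpace (Ω i)]
    (μ : ∀ i, Measure (Ω i)) [∀ i, IsProbabilityMeasure (μ i)] {f : ∀ i, Ω i → ℝ≥0∞}
    (hf : ∀ i, Measurable (f i)) [∀ i, SigmaFinite ((μ i).withDensity (f i))] :
    Measure.pi (fun i => (μ i).withDensity (f i)) =
      (Measure.pi μ).withDensity fun x => ∏ i, f i (x i) := by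
  refine Measure.pi_eq fun s hs => ?_
  rw [withDensity_apply _ (MeasurableSet.univ_pi hs),
    ← lintegral_indicator (MeasurableSet.univ_pi hs)]
  have e : (Set.univ.pi s).indicator (fun x => ∏ i, f i (x i)) =
      fun x => ∏ i, (s i).indicator (f i) (x i) := by
    ext x
    by_cases hx : x ∈ Set.univ.pi s
    · rw [Set.indicator_of_mem hx]
      exact Finset.prod_congr rfl fun i _ => by rw [Set.indicator_of_mem (hx i trivial)]
    · rw [Set.indicator_of_notMem hx]
      simp only [Set.mem_pi, Set.mem_univ, true_implies, not_forall] at hx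
      obtain ⟨i, hi⟩ := hx
      exact (Finset.prod_eq_zero (Finset.mem_univ i) (Set.indicator_of_notMem hi _)).symm
  rw [e, lintegral_pi_prod μ fun i => (hf i).indicator (hs i)]
  exact Finset.prod_congr rfl fun i _ => by
    rw [lintegral_indicator (hs i), withDensity_apply _ (hs i)]

instance (X : Matrix (Fin n) (Fin p) ℝ) (θ : Fin p → ℝ) : IsProbabilityMeasure (dataLaw X θ) := by
  unfold dataLaw; infer_instance

/-- The moment generating function of the noise `Y - X θ` under `P_θ`. -/
lemma lintegral_exp_noise (X : Matrix (Fin n) (Fin p) ℝ) (θ : Fin p → ℝ) (v : Fin n → ℝ) :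
    ∫⁻ Y, ENNReal.ofReal (Real.exp (v ⬝ᵥ (Y - X *ᵥ θ))) ∂(dataLaw X θ) =
      ENNReal.ofReal (Real.exp (l2norm v ^ 2 / 2)) := by
  have e : ∀ Y : Fin n → ℝ, ENNReal.ofReal (Real.exp (v ⬝ᵥ (Y - X *ᵥ θ))) =
      ∏ j, ENNReal.ofReal (Real.exp (v j * (Y j - (X *ᵥ θ) j))) := fun Y => by
    rw [← ENNReal.ofReal_prod_of_nonneg fun _ _ => (Real.exp_pos _).le, ← Real.exp_sum]; rfl
  simp_rw [e]
  rw [dataLaw, lintegral_pi_prod _ (f := fun j y =>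
    ENNReal.ofReal (Real.exp (v j * (y - (X *ᵥ θ) j)))) fun j => by fun_prop]
  have e1 : ∀ j, ∫⁻ y, ENNReal.ofReal (Real.exp (v j * (y - (X *ᵥ θ) j)))
      ∂(gaussianReal ((X *ᵥ θ) j) 1) = ENNReal.ofReal (Real.exp (v j ^ 2 / 2)) := fun j => by
    have e2 : ∀ y, Real.exp (v j * (y - (X *ᵥ θ) j)) =
        Real.exp (-(v j * (X *ᵥ θ) j)) * Real.exp (v j * y) := fun y => by
      rw [← Real.exp_add]; ring_nf
    simp_rw [e2]
    rw [← ofReal_integral_eq_lintegral_ofReal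
      ((integrable_exp_mul_gaussianReal (v j)).const_mul _) (ae_of_all _ fun _ => by positivity),
      integral_const_mul]
    have := congrFun (mgf_fun_id_gaussianReal (μ := (X *ᵥ θ) j) (v := 1)) (v j)
    simp only [mgf] at this
    rw [this, ← Real.exp_add]
    congr 2
    push_cast; ring
  simp_rw [e1]
  rw [← ENNReal.ofReal_prod_of_nonneg fun _ _ => (Real.exp_pos _).le, ← Real.exp_sum, l2norm_sq,
    Finset.sum_div]

/-- The event that the noise has correlation at most `t` with each column of `X`. -/
def noiseEvent (X : Matrix (Fin n) (Fin p) ℝ) (θ : Fin p → ℝ) (t : ℝ) : Set (Fin n → ℝ) :=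
  {Y | ∀ i, |X.col i ⬝ᵥ (Y - X *ᵥ θ)| ≤ t}

lemma continuous_dotProduct_noise (X : Matrix (Fin n) (Fin p) ℝ) (θ : Fin p → ℝ) (v : Fin n → ℝ) :
    Continuous fun Y : Fin n → ℝ => v ⬝ᵥ (Y - X *ᵥ θ) :=
  continuous_finsetSum _ fun j _ => continuous_const.mul ((continuous_apply j).sub continuous_const)

lemma measurableSet_noiseEvent (X : Matrix (Fin n) (Fin p) ℝ) (θ : Fin p → ℝ) (t : ℝ) :
    MeasurableSet (noiseEvent X θ t) := by
  rw [noiseEvent, Set.ofPred_forall]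
  exact MeasurableSet.iInter fun i => measurableSet_le
    (continuous_dotProduct_noise X θ _).abs.measurable measurable_const

/-- Chernoff's bound for a linear functional of the noise. -/
lemma noise_tail_le (X : Matrix (Fin n) (Fin p) ℝ) (θ : Fin p → ℝ) {v : Fin n → ℝ} {c t : ℝ}
    (hc : 0 < c) (hv : l2norm v ≤ c) (ht : 0 ≤ t) :
    dataLaw X θ {Y | t < v ⬝ᵥ (Y - X *ᵥ θ)} ≤
      ENNReal.ofReal (Real.exp (-(t ^ 2 / (2 * c ^ 2)))) := by
  set a := t / c ^ 2
  have ha : 0 ≤ a := by positivity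
  have h1 := lintegral_exp_noise X θ (a • v)
  have h2 := mul_meas_ge_le_lintegral (μ := dataLaw X θ)
    (f := fun Y => ENNReal.ofReal (Real.exp ((a • v) ⬝ᵥ (Y - X *ᵥ θ))))
    (by have := (continuous_dotProduct_noise X θ (a • v)).measurable; fun_prop)
    (ENNReal.ofReal (Real.exp (a * t)))
  rw [h1] at h2
  have h3 : {Y | t < v ⬝ᵥ (Y - X *ᵥ θ)} ⊆ {Y | ENNReal.ofReal (Real.exp (a * t)) ≤
      ENNReal.ofReal (Real.exp ((a • v) ⬝ᵥ (Y - X *ᵥ θ)))} := fun Y hY => by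
    rw [Set.mem_ofPred_eq] at hY ⊢
    refine ENNReal.ofReal_le_ofReal (Real.exp_le_exp.2 ?_)
    rw [smul_dotProduct, smul_eq_mul]
    exact mul_le_mul_of_nonneg_left hY.le ha
  have h4 : l2norm (a • v) ^ 2 ≤ a ^ 2 * c ^ 2 := by
    have : l2norm (a • v) ^ 2 = a ^ 2 * l2norm v ^ 2 := by
      simp [l2norm_sq, mul_pow, Finset.mul_sum]
    rw [this]
    gcongr
    exact l2norm_nonneg v
  have h5 : -(t ^ 2 / (2 * c ^ 2)) = a ^ 2 * c ^ 2 / 2 - a * t := by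
    simp only [a]; field_simp; ring
  calc _ ≤ dataLaw X θ _ := measure_mono h3
    _ ≤ ENNReal.ofReal (Real.exp (l2norm (a • v) ^ 2 / 2)) / ENNReal.ofReal (Real.exp (a * t)) := by
      rw [ENNReal.le_div_iff_mul_le (by simp [Real.exp_pos]) (by simp), mul_comm]
      exact h2
    _ = ENNReal.ofReal (Real.exp (l2norm (a • v) ^ 2 / 2 - a * t)) := by
      rw [← ENNReal.ofReal_div_of_pos (Real.exp_pos _), ← Real.exp_sub]
    _ ≤ _ := by
      rw [h5]
      gcongr

lemma dataLaw_compl_noiseEvent_le (hp : 2 ≤ p) (hX : 0 < colNorm X) (θ : Fin p → ℝ) :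
    dataLaw X θ (noiseEvent X θ (lamBar X))ᶜ ≤ ENNReal.ofReal (2 / p) := by
  have hp0 : (0 : ℝ) < p := by exact_mod_cast (by lia : 0 < p)
  have hlog : 0 ≤ Real.log p := Real.log_natCast_nonneg p
  have ht : 0 ≤ lamBar X := by unfold lamBar; positivity
  have hexp : Real.exp (-(lamBar X ^ 2 / (2 * colNorm X ^ 2))) = 1 / (p : ℝ) ^ 2 := by
    have : lamBar X ^ 2 / (2 * colNorm X ^ 2) = Real.log p + Real.log p := by
      rw [lamBar, mul_pow, mul_pow, Real.sq_sqrt hlog]; field_simp; ring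
    rw [this, Real.exp_neg, Real.exp_add, Real.exp_log hp0]; field_simp
  have hsub : (noiseEvent X θ (lamBar X))ᶜ ⊆
      ⋃ i, ({Y | lamBar X < X.col i ⬝ᵥ (Y - X *ᵥ θ)} ∪
        {Y | lamBar X < (-X.col i) ⬝ᵥ (Y - X *ᵥ θ)}) := fun Y hY => by
    simp only [noiseEvent, Set.mem_compl_iff, Set.mem_ofPred_eq, not_forall, not_le] at hY
    obtain ⟨i, hi⟩ := hY
    refine Set.mem_iUnion.2 ⟨i, ?_⟩
    rcases lt_abs.1 hi with h | h
    · exact Or.inl h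
    · exact Or.inr (by rw [Set.mem_ofPred_eq, neg_dotProduct]; exact h)
  have hneg : ∀ i, l2norm (-X.col i) = l2norm (X.col i) := fun i => by simp [l2norm]
  calc _ ≤ dataLaw X θ _ := measure_mono hsub
    _ ≤ ∑ i, dataLaw X θ _ := measure_iUnion_fintype_le _ _
    _ ≤ ∑ _i : Fin p, ENNReal.ofReal (2 / (p : ℝ) ^ 2) := by
      refine Finset.sum_le_sum fun i _ => (measure_union_le _ _).trans ?_
      have h1 := noise_tail_le X θ hX (l2norm_col_le X i) ht
      have h2 := noise_tail_le X θ hX ((hneg i).trans_le (l2norm_col_le X i)) ht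
      refine (add_le_add h1 h2).trans ?_
      rw [hexp, ← ENNReal.ofReal_add (by positivity) (by positivity)]
      exact ENNReal.ofReal_le_ofReal (by rw [← add_div]; norm_num)
    _ = ENNReal.ofReal (2 / p) := by
      rw [Finset.sum_const, Finset.card_univ, Fintype.card_fin, nsmul_eq_mul,
        ← ENNReal.ofReal_natCast, ← ENNReal.ofReal_mul hp0.le]
      congr 1; field_simp

/-! ### Kullback-Leibler divergence -/

/-- If `Q` has log-density `G` with respect to a component `c • ν` of `P`, up to the factor `c`,
then the divergence from `P` is finite and is at most that from the component. -/
lemma llr_le_of_smul_le {Ω : Type*} [MeasurableSpace Ω] {Q ν P : Measure Ω}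
    [IsProbabilityMeasure Q] [IsFiniteMeasure ν] [IsProbabilityMeasure P] {G : Ω → ℝ}
    (hG : Measurable G) (hQ : Q = ν.withDensity fun x => ENNReal.ofReal (Real.exp (G x))) {c : ℝ}
    (hc : 0 < c) (hle : ENNReal.ofReal c • ν ≤ P) (hint : Integrable G Q) :
    Q ≪ P ∧ Integrable (llr Q P) Q ∧ ∫ x, llr Q P x ∂Q ≤ ∫ x, G x ∂Q - Real.log c := by
  have hc' : ENNReal.ofReal c ≠ 0 := by simpa using hc
  have hQν : Q ≪ ν := hQ ▸ withDensity_absolutelyContinuous _ _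
  have hνP : ν ≪ P := (Measure.absolutelyContinuous_smul hc').trans
    (Measure.absolutelyContinuous_of_le hle)
  have hQP := hQν.trans hνP
  have h1 : ∀ᵐ x ∂Q, Q.rnDeriv P x = Q.rnDeriv ν x * ν.rnDeriv P x := by
    filter_upwards [hQP.ae_le (Measure.rnDeriv_mul_rnDeriv (κ := P) hQν)] with x hx
    exact hx.symm
  have h2 : ∀ᵐ x ∂Q, Q.rnDeriv ν x = ENNReal.ofReal (Real.exp (G x)) := by
    have h := Measure.rnDeriv_withDensity ν
      (f := fun x => ENNReal.ofReal (Real.exp (G x))) (by fun_prop)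
    rw [← hQ] at h
    exact hQν.ae_le h
  have h3 : ∀ᵐ x ∂Q, ENNReal.ofReal c * ν.rnDeriv P x ≤ 1 := by
    filter_upwards [hQP.ae_le (Measure.rnDeriv_le_one_of_le hle),
      hQP.ae_le (Measure.rnDeriv_smul_left_of_ne_top ν P (r := ENNReal.ofReal c) (by simp))]
      with x hx hx'
    rw [hx'] at hx
    simpa using hx
  have hub : ∀ᵐ x ∂Q, llr Q P x ≤ G x - Real.log c := by
    filter_upwards [h1, h2, h3, Measure.rnDeriv_pos hQP, hQP.ae_le (Measure.rnDeriv_lt_top Q P)]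
      with x e1 e2 e3 e4 e5
    have hr : 0 < (Q.rnDeriv P x).toReal := ENNReal.toReal_pos e4.ne' e5.ne
    rw [llr, ← Real.log_exp (G x), ← Real.log_div (Real.exp_pos _).ne' hc.ne']
    refine Real.log_le_log hr ?_
    rw [le_div_iff₀ hc]
    have : Q.rnDeriv P x * ENNReal.ofReal c ≤ ENNReal.ofReal (Real.exp (G x)) := by
      rw [e1, e2, mul_assoc, mul_comm _ (ENNReal.ofReal c)]
      exact mul_le_of_le_one_right' e3
    have h := ENNReal.toReal_mono (by simp) this
    rwa [ENNReal.toReal_mul, ENNReal.toReal_ofReal hc.le,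
      ENNReal.toReal_ofReal (Real.exp_pos _).le] at h
  have hv : Integrable (fun x => G x - Real.log c) Q := hint.sub (integrable_const _)
  -- the negative part of `r log r` is bounded, so the negative part of `llr` is integrable
  have hneg : Integrable (fun x => min (llr Q P x) 0) Q := by
    rw [← integrable_rnDeriv_smul_iff hQP]
    refine Integrable.of_bound (C := 1) ?_ (ae_of_all _ fun x => ?_)
    · exact ((Measure.measurable_rnDeriv _ _).ennreal_toReal.smul
        ((measurable_llr Q P).min measurable_const)).aestronglyMeasurable
    · set r := (Q.rnDeriv P x).toReal with hr
      have hr0 : 0 ≤ r := ENNReal.toReal_nonneg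
      have hl : llr Q P x = Real.log r := rfl
      rw [hl, smul_eq_mul, Real.norm_eq_abs, abs_le]
      rcases hr0.eq_or_lt with h0 | h0
      · rw [← h0]; simp
      · have h4 := Real.one_sub_inv_le_log_of_pos h0
        have h5 : r * (1 - r⁻¹) = r - 1 := by field_simp
        have h6 := mul_le_mul_of_nonneg_left h4 hr0
        constructor
        · rcases min_cases (Real.log r) 0 with ⟨h, -⟩ | ⟨h, -⟩ <;> rw [h] <;> linarith
        · exact (mul_nonpos_of_nonneg_of_nonpos hr0 (min_le_right _ _)).trans zero_le_one
  have hllr : Integrable (llr Q P) Q := by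
    refine (hv.abs.add hneg.abs).mono' (measurable_llr Q P).aestronglyMeasurable ?_
    filter_upwards [hub] with x hx
    rw [Real.norm_eq_abs, Pi.add_apply]
    rcases le_total (llr Q P x) 0 with h | h
    · rw [min_eq_left h]
      exact le_add_of_nonneg_left (abs_nonneg _)
    · rw [abs_of_nonneg h]
      have := abs_nonneg (min (llr Q P x) 0)
      linarith [le_abs_self (G x - Real.log c)]
  refine ⟨hQP, hllr, (integral_mono_ae hllr hv hub).trans_eq ?_⟩
  rw [integral_sub hint (integrable_const _)]
  simp

/-- A distribution `Q` close to `P` in Kullback-Leibler divergence gives little mass to any set of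
exponentially small `P`-mass: the Donsker-Varadhan inequality for a multiple of an indicator. -/
lemma measureReal_mul_le_of_klDiv_le {Ω : Type*} [MeasurableSpace Ω] {Q P : Measure Ω}
    [IsProbabilityMeasure Q] [IsProbabilityMeasure P] {κ a : ℝ} (hκ : 0 ≤ κ)
    (hKL : klDiv Q P ≤ ENNReal.ofReal κ) {E : Set Ω} (hE : MeasurableSet E)
    (hPE : P E ≤ ENNReal.ofReal (Real.exp (-a))) :
    a * Q.real E ≤ κ + Real.log 2 := by
  obtain ⟨hQP, hllr⟩ := klDiv_ne_top_iff.1 (hKL.trans_lt ENNReal.ofReal_lt_top).ne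
  set f : Ω → ℝ := E.indicator fun _ => a
  have hf : Measurable f := measurable_const.indicator hE
  have hfQ : Integrable f Q := (integrable_const a).indicator hE
  have hexp : (fun x => Real.exp (f x)) = fun x => 1 + E.indicator (fun _ => Real.exp a - 1) x := by
    ext x; by_cases hx : x ∈ E <;> simp [f, hx]
  have hi : Integrable (fun x => E.indicator (fun _ => Real.exp a - 1) x) P :=
    (integrable_const (Real.exp a - 1)).indicator hE
  have hfP : Integrable (fun x => Real.exp (f x)) P := by
    rw [hexp]; exact (integrable_const _).add hi
  have hI : ∫ x, Real.exp (f x) ∂P ≤ 2 := by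
    rw [hexp, integral_add (integrable_const _) hi, integral_indicator_const _ hE]
    have h1 : P.real E ≤ Real.exp (-a) := ENNReal.toReal_le_of_le_ofReal (Real.exp_pos _).le hPE
    have h2 : P.real E * Real.exp a ≤ Real.exp (-a) * Real.exp a := by gcongr
    rw [← Real.exp_add] at h2
    have h3 : 0 ≤ P.real E := measureReal_nonneg
    simp only [integral_const, probReal_univ, smul_eq_mul]
    simp only [neg_add_cancel, Real.exp_zero] at h2
    linarith
  have hprob := isProbabilityMeasure_tilted hfP
  have h0 := integral_llr_add_sub_measure_univ_nonneg
    (hQP.trans (absolutelyContinuous_tilted hfP)) (integrable_llr_tilted_right hQP hfQ hllr hfP)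
  rw [integral_llr_tilted_right hQP hfQ hfP hllr, integral_indicator_const _ hE] at h0
  have h1 : ∫ x, llr Q P x ∂Q ≤ κ := by
    have := toReal_klDiv_of_measure_eq hQP (by simp)
    rw [← this]
    exact ENNReal.toReal_le_of_le_ofReal hκ hKL
  have h2 := Real.log_le_log (integral_exp_pos hfP) hI
  simp only [probReal_univ, smul_eq_mul] at h0
  linarith

/-! ### The Laplace distribution and the model selection prior -/

lemma lintegral_exp_neg_abs_sub {lam c : ℝ} (hlam : 0 ≤ lam) (hc : 0 < c) (a : ℝ) :
    ∫⁻ x : ℝ, ENNReal.ofReal (lam / 2 * Real.exp (-(c * |x - a|))) = ENNReal.ofReal (lam / c) := by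
  have h1 : ∫ x : ℝ, Real.exp (-(c * |x|)) = 2 / c := by
    rw [integral_comp_abs (f := fun x => Real.exp (-(c * x)))]
    have := integral_exp_mul_Ioi (neg_lt_zero.2 hc) 0
    simp only [neg_mul, mul_zero, Real.exp_zero] at this
    rw [this]; field_simp
  have h2 : Integrable fun x : ℝ => Real.exp (-(c * |x|)) := by
    by_contra h
    rw [integral_undef h] at h1
    exact (by positivity : 2 / c ≠ 0) h1.symm
  rw [lintegral_sub_right_eq_self
    (fun x : ℝ => ENNReal.ofReal (lam / 2 * Real.exp (-(c * |x|)))) a,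
    ← ofReal_integral_eq_lintegral_ofReal (h2.const_mul _) (ae_of_all _ fun _ => by positivity),
    integral_const_mul, h1]
  congr 1; field_simp

lemma isProbabilityMeasure_laplace {lam : ℝ} (hlam : 0 < lam) :
    IsProbabilityMeasure (laplace lam) := by
  refine ⟨?_⟩
  rw [laplace, withDensity_apply _ MeasurableSet.univ, Measure.restrict_univ]
  have := lintegral_exp_neg_abs_sub hlam.le hlam 0
  simpa [hlam.ne'] using this

/-- The prior conditionally on the model `S`. -/
noncomputable def slab (lam : ℝ) (S : Finset (Fin p)) : Measure (Fin p → ℝ) :=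
  Measure.pi fun i => if i ∈ S then laplace lam else Measure.dirac 0

lemma isProbabilityMeasure_ite {Ω : Type*} [MeasurableSpace Ω] (q : Prop) [Decidable q]
    {μ ν : Measure Ω} [IsProbabilityMeasure μ] [IsProbabilityMeasure ν] :
    IsProbabilityMeasure (if q then μ else ν) := by
  split_ifs <;> infer_instance

lemma isProbabilityMeasure_slab {lam : ℝ} (hlam : 0 < lam) (S : Finset (Fin p)) :
    IsProbabilityMeasure (slab lam S) := by
  have := isProbabilityMeasure_laplace hlam
  have : ∀ i, IsProbabilityMeasure (if i ∈ S then laplace lam else Measure.dirac (0 : ℝ)) :=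
    fun i => isProbabilityMeasure_ite _
  unfold slab; infer_instance

lemma slab_ae_eq_zero {lam : ℝ} (hlam : 0 < lam) (S : Finset (Fin p)) :
    ∀ᵐ θ ∂(slab lam S), ∀ i ∉ S, θ i = 0 := by
  have := isProbabilityMeasure_laplace hlam
  have : ∀ i, IsProbabilityMeasure (if i ∈ S then laplace lam else Measure.dirac (0 : ℝ)) :=
    fun i => isProbabilityMeasure_ite _
  rw [ae_all_iff]
  intro i
  by_cases hi : i ∈ S
  · exact ae_of_all _ fun _ h => absurd hi h
  · have h := measurePreserving_eval
      (fun i => if i ∈ S then laplace lam else Measure.dirac (0 : ℝ)) i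
    simp only [hi, if_false] at h
    have h2 : ∀ᵐ x ∂(Measure.dirac (0 : ℝ)), x = 0 := by simp [ae_dirac_eq]
    filter_upwards [h.quasiMeasurePreserving.ae h2] with θ hθ _ using hθ

/-- The integral, conditionally on the model `S`, that remains when the Laplace density of `θ` is
replaced by a wider one centered at `θ₀`: each active coordinate costs a factor `4`. -/
lemma lintegral_slab_le {lam : ℝ} (hlam : 0 < lam) (S : Finset (Fin p)) (θ₀ : Fin p → ℝ) :
    ∫⁻ θ, ENNReal.ofReal (Real.exp (lam * l1norm θ - lam / 4 * l1norm (θ - θ₀))) ∂(slab lam S) ≤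
      ENNReal.ofReal (4 ^ S.card) := by
  have := isProbabilityMeasure_laplace hlam
  have : ∀ i, IsProbabilityMeasure (if i ∈ S then laplace lam else Measure.dirac (0 : ℝ)) :=
    fun i => isProbabilityMeasure_ite _
  have e : ∀ θ : Fin p → ℝ,
      ENNReal.ofReal (Real.exp (lam * l1norm θ - lam / 4 * l1norm (θ - θ₀))) =
        ∏ i, ENNReal.ofReal (Real.exp (lam * |θ i| - lam / 4 * |θ i - θ₀ i|)) := fun θ => by
    rw [← ENNReal.ofReal_prod_of_nonneg fun _ _ => (Real.exp_pos _).le, ← Real.exp_sum]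
    simp [l1norm, Finset.mul_sum, Finset.sum_sub_distrib]
  simp_rw [e]
  rw [slab, lintegral_pi_prod _ (f := fun i x =>
    ENNReal.ofReal (Real.exp (lam * |x| - lam / 4 * |x - θ₀ i|))) fun i => by fun_prop]
  have h4 : ENNReal.ofReal (4 ^ S.card) = ∏ i, if i ∈ S then ENNReal.ofReal 4 else 1 := by
    rw [Finset.prod_ite_mem, Finset.univ_inter, Finset.prod_const, ENNReal.ofReal_pow (by norm_num)]
  rw [h4]
  refine Finset.prod_le_prod' fun i _ => ?_
  split_ifs with hi
  · rw [laplace, lintegral_withDensity_eq_lintegral_mul _ (by fun_prop) (by fun_prop)]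
    have h := lintegral_exp_neg_abs_sub hlam.le (by positivity : 0 < lam / 4) (θ₀ i)
    have h5 : lam / (lam / 4) = 4 := by field_simp
    rw [h5] at h
    rw [← h]
    refine (lintegral_congr fun x => ?_).le
    rw [Pi.mul_apply, ← ENNReal.ofReal_mul (by positivity), mul_assoc, ← Real.exp_add]
    congr 3; ring
  · rw [lintegral_dirac' _ (by fun_prop), ENNReal.ofReal_le_one]
    have : 0 ≤ lam / 4 * |0 - θ₀ i| := by positivity
    simpa using this

lemma measurable_card_supp : Measurable fun θ : Fin p → ℝ => (supp θ).card := by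
  simp only [supp, Finset.card_filter]
  refine Finset.measurable_sum _ fun i _ => Measurable.ite ?_ measurable_const measurable_const
  exact (measurableSet_eq_fun (measurable_pi_apply i) measurable_const).compl

section Weights

variable {A₁ A₂ A₃ A₄ : ℝ} {w : ℕ → ℝ} {lam : ℝ}

namespace PriorCond

lemma colNorm_pos (h : PriorCond A₁ A₂ A₃ A₄ X w lam) : 0 < colNorm X := by
  refine (colNorm_nonneg X).lt_of_ne fun h0 => ?_
  have h1 := h.lam_upper
  rw [lamBar, ← h0] at h1
  have := h.lam_pos
  simp only [mul_zero, zero_mul] at h1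
  linarith

lemma lamBar_pos (h : PriorCond A₁ A₂ A₃ A₄ X w lam) : 0 < lamBar X := by
  have h1 := h.lam_upper
  have := h.lam_pos
  linarith

lemma weight_le (h : PriorCond A₁ A₂ A₃ A₄ X w lam) (hA₂ : 0 < A₂) :
    ∀ s ≤ p, w s ≤ (A₂ * (p : ℝ) ^ (-A₄)) ^ s * w 0 := by
  intro s
  induction s with
  | zero => simp
  | succ s ih =>
    intro hs
    refine (h.upper (s + 1) (by lia) hs).trans ?_
    rw [pow_succ', mul_assoc (A₂ * _)]
    exact mul_le_mul_of_nonneg_left (ih (by lia)) (by positivity)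

lemma le_weight (h : PriorCond A₁ A₂ A₃ A₄ X w lam) (hA₁ : 0 < A₁) :
    ∀ s ≤ p, (A₁ * (p : ℝ) ^ (-A₃)) ^ s * w 0 ≤ w s := by
  intro s
  induction s with
  | zero => simp
  | succ s ih =>
    intro hs
    refine le_trans ?_ (h.lower (s + 1) (by lia) hs)
    rw [pow_succ', mul_assoc (A₁ * _)]
    exact mul_le_mul_of_nonneg_left (ih (by lia)) (by positivity)

lemma weight_zero_le_one (h : PriorCond A₁ A₂ A₃ A₄ X w lam) : w 0 ≤ 1 := by
  rw [← h.sum_eq_one]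
  exact Finset.single_le_sum (fun s hs => h.nonneg s (by simpa [Nat.lt_succ_iff] using hs))
    (by simp)

lemma sum_weight_mul_le (h : PriorCond A₁ A₂ A₃ A₄ X w lam) (hA₂ : 0 < A₂) {b : ℝ} (hb : 0 ≤ b)
    (hq : b * (A₂ * (p : ℝ) ^ (-A₄)) ≤ 1 / 2) (R : ℕ) :
    ∑ s ∈ Finset.range (p + 1), (if R ≤ s then w s * b ^ s else 0) ≤
      2 * (b * (A₂ * (p : ℝ) ^ (-A₄))) ^ R * w 0 := by
  set q := b * (A₂ * (p : ℝ) ^ (-A₄))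
  have hq0 : 0 ≤ q := by positivity
  have hw0 : 0 ≤ w 0 := h.nonneg 0 (by lia)
  have h1 : ∑ s ∈ Finset.range (p + 1), (if R ≤ s then w s * b ^ s else 0) ≤
      ∑ s ∈ Finset.Ico R (p + 1), q ^ s * w 0 := by
    rw [← Finset.sum_filter]
    have e : Finset.filter (fun s => R ≤ s) (Finset.range (p + 1)) = Finset.Ico R (p + 1) := by
      ext s; simp [and_comm]
    rw [e]
    refine Finset.sum_le_sum fun s hs => ?_
    have hs' : s ≤ p := by have := (Finset.mem_Ico.1 hs).2; lia
    rw [mul_pow, mul_comm, mul_assoc]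
    exact mul_le_mul_of_nonneg_left (h.weight_le hA₂ s hs') (by positivity)
  rw [← Finset.sum_mul] at h1
  refine h1.trans (mul_le_mul_of_nonneg_right ?_ hw0)
  refine (geom_sum_Ico_le_of_lt_one hq0 (by linarith)).trans ?_
  rw [div_le_iff₀ (by linarith)]
  have : 0 ≤ q ^ R := by positivity
  nlinarith

lemma half_le_weight_zero (h : PriorCond A₁ A₂ A₃ A₄ X w lam) (hA₂ : 0 < A₂)
    (hq : A₂ * (p : ℝ) ^ (-A₄) ≤ 1 / 2) : 1 / 2 ≤ w 0 := by
  have h1 := h.sum_weight_mul_le hA₂ (b := 1) zero_le_one (by simpa using hq) 0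
  simp only [zero_le, if_true, one_pow, mul_one, pow_zero, h.sum_eq_one] at h1
  linarith

end PriorCond

lemma prior_eq (w : ℕ → ℝ) (lam : ℝ) :
    prior p w lam = ∑ S : Finset (Fin p),
      ENNReal.ofReal (w S.card / (p.choose S.card : ℝ)) • slab lam S := rfl

lemma smul_slab_le_prior (w : ℕ → ℝ) (lam : ℝ) (S : Finset (Fin p)) :
    ENNReal.ofReal (w S.card / (p.choose S.card : ℝ)) • slab lam S ≤ prior p w lam := by
  rw [prior_eq]
  refine Measure.le_iff.2 fun s _ => ?_
  rw [Measure.finsetSum_apply]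
  exact Finset.single_le_sum
    (f := fun S : Finset (Fin p) =>
      (ENNReal.ofReal (w S.card / (p.choose S.card : ℝ)) • slab lam S) s)
    (fun _ _ => zero_le) (Finset.mem_univ S)

/-- A sum over models of a function of their dimension is a sum over dimensions. -/
lemma sum_models (w : ℕ → ℝ) (f : ℕ → ℝ) (hw : ∀ s ≤ p, 0 ≤ w s) (hf : ∀ s, 0 ≤ f s) :
    ∑ S : Finset (Fin p), ENNReal.ofReal (w S.card / (p.choose S.card : ℝ)) *
      ENNReal.ofReal (f S.card) = ENNReal.ofReal (∑ s ∈ Finset.range (p + 1), w s * f s) := by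
  have hS : ∀ S : Finset (Fin p), S.card ≤ p := fun S => by simpa using S.card_le_univ
  have h0 : ∀ S : Finset (Fin p), 0 ≤ w S.card / (p.choose S.card : ℝ) := fun S =>
    div_nonneg (hw _ (hS S)) (Nat.cast_nonneg _)
  simp_rw [← ENNReal.ofReal_mul (h0 _)]
  rw [← ENNReal.ofReal_sum_of_nonneg fun S _ => mul_nonneg (h0 S) (hf _)]
  congr 1
  rw [← Finset.powerset_univ, Finset.sum_powerset_apply_card
    (fun m => w m / (p.choose m : ℝ) * f m), Finset.card_univ, Fintype.card_fin]
  refine Finset.sum_congr rfl fun s hs => ?_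
  have : (0 : ℝ) < p.choose s := by
    exact_mod_cast Nat.choose_pos (by simpa [Nat.lt_succ_iff] using hs)
  rw [nsmul_eq_mul]; field_simp

lemma isProbabilityMeasure_prior (h : PriorCond A₁ A₂ A₃ A₄ X w lam) :
    IsProbabilityMeasure (prior p w lam) := by
  have := fun S : Finset (Fin p) => isProbabilityMeasure_slab h.lam_pos S
  refine ⟨?_⟩
  rw [prior_eq, Measure.finsetSum_apply]
  have h1 := sum_models w (fun _ => 1) h.nonneg fun _ => zero_le_one
  simpa [h.sum_eq_one] using h1

/-- The prior mass of large models, inflated by a factor `4` for each active coordinate. -/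
lemma lintegral_prior_le (h : PriorCond A₁ A₂ A₃ A₄ X w lam) (hA₂ : 0 < A₂)
    (hq : 4 * (A₂ * (p : ℝ) ^ (-A₄)) ≤ 1 / 2) (θ₀ : Fin p → ℝ) (R : ℕ) :
    ∫⁻ θ in {θ | R ≤ (supp θ).card},
        ENNReal.ofReal (Real.exp (lam * l1norm θ - lam / 4 * l1norm (θ - θ₀))) ∂(prior p w lam) ≤
      ENNReal.ofReal (2 * (4 * (A₂ * (p : ℝ) ^ (-A₄))) ^ R) := by
  have hR : MeasurableSet {θ : Fin p → ℝ | R ≤ (supp θ).card} :=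
    measurableSet_le measurable_const measurable_card_supp
  rw [← lintegral_indicator hR, prior_eq, lintegral_finsetSum_measure]
  have h1 : ∀ S : Finset (Fin p), ∫⁻ θ in {θ | R ≤ (supp θ).card},
      ENNReal.ofReal (Real.exp (lam * l1norm θ - lam / 4 * l1norm (θ - θ₀))) ∂(slab lam S) ≤
        ENNReal.ofReal (if R ≤ S.card then 4 ^ S.card else 0) := fun S => by
    split_ifs with hS
    · exact (setLIntegral_le_lintegral _ _).trans (lintegral_slab_le h.lam_pos S θ₀)
    · rw [setLIntegral_measure_zero _ _ ?_, ENNReal.ofReal_zero]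
      have h2 := ae_iff.1 (slab_ae_eq_zero h.lam_pos S)
      refine measure_mono_null (fun θ hθ (hcon : ∀ i ∉ S, θ i = 0) => hS ?_) h2
      refine le_trans (by simpa using hθ) (Finset.card_le_card fun i hi => ?_)
      by_contra hiS
      exact mem_supp.1 hi (hcon i hiS)
  have h3 := sum_models (p := p) w (fun s => if R ≤ s then 4 ^ s else 0) h.nonneg
    fun s => by split_ifs <;> positivity
  calc _ ≤ ∑ S : Finset (Fin p), ENNReal.ofReal (w S.card / (p.choose S.card : ℝ)) *
        ENNReal.ofReal (if R ≤ S.card then 4 ^ S.card else 0) := by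
        refine Finset.sum_le_sum fun S _ => ?_
        rw [lintegral_smul_measure, smul_eq_mul, lintegral_indicator hR]
        exact mul_le_mul_right (h1 S) _
    _ = _ := h3
    _ ≤ _ := by
        refine ENNReal.ofReal_le_ofReal ?_
        simp only [mul_ite, mul_zero]
        refine (h.sum_weight_mul_le hA₂ (by norm_num) hq R).trans ?_
        exact mul_le_of_le_one_right (by positivity) h.weight_zero_le_one

end Weights

/-! ### A Gaussian competitor centered at the truth -/

/-- The coordinate distributions of `oracle`. -/
noncomputable def oracleFactor (θ₀ : Fin p → ℝ) (σ : ℝ≥0) (i : Fin p) : Measure ℝ :=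
  if i ∈ supp θ₀ then gaussianReal (θ₀ i) (σ ^ 2) else Measure.dirac 0

/-- The Gaussian distribution with mean `θ₀` and covariance `σ² I` on the coordinates in the support
of `θ₀`, extended by zero. It does not depend on the data. -/
noncomputable def oracle (θ₀ : Fin p → ℝ) (σ : ℝ≥0) : Measure (Fin p → ℝ) :=
  Measure.pi (oracleFactor θ₀ σ)

instance (θ₀ : Fin p → ℝ) (σ : ℝ≥0) (i : Fin p) : IsProbabilityMeasure (oracleFactor θ₀ σ i) :=
  isProbabilityMeasure_ite _

instance (θ₀ : Fin p → ℝ) (σ : ℝ≥0) : IsProbabilityMeasure (oracle θ₀ σ) := by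
  unfold oracle; infer_instance

lemma oracle_mem_familyPMF (θ₀ : Fin p → ℝ) {σ : ℝ≥0} (hσ : 0 < σ) :
    oracle θ₀ σ ∈ familyPMF p := by
  refine ⟨θ₀, fun _ => σ, fun i => if i ∈ supp θ₀ then 1 else 0, fun _ => hσ, fun i => ?_, ?_⟩
  · by_cases hi : i ∈ supp θ₀ <;> simp [hi]
  · rw [oracle]
    congr 1
    ext1 i
    by_cases hi : i ∈ supp θ₀ <;> simp [oracleFactor, hi]

open scoped MatrixOrder in
lemma sqrt_scalar (ι : Type*) [Fintype ι] [DecidableEq ι] (σ : ℝ≥0) :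
    CFC.sqrt ((σ : ℝ) ^ 2 • (1 : Matrix ι ι ℝ)) = (σ : ℝ) • 1 := by
  refine CFC.sqrt_unique ?_ ?_
  · rw [smul_mul_smul_comm, mul_one, sq]
  · rw [Matrix.nonneg_iff_posSemidef]
    exact Matrix.PosSemidef.one.smul σ.coe_nonneg

lemma measurable_extendZero (S : Finset (Fin p)) : Measurable (extendZero S) := by
  refine measurable_pi_lambda _ fun i => ?_
  unfold extendZero
  by_cases hi : i ∈ S
  · simp only [hi, dif_pos]; fun_prop
  · simp only [hi, dif_neg, not_false_eq_true]; fun_prop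

lemma gaussianOn_eq_oracle (θ₀ : Fin p → ℝ) (σ : ℝ≥0) :
    gaussianOn (supp θ₀) (WithLp.toLp 2 fun i : supp θ₀ => θ₀ i) ((σ : ℝ) ^ 2 • 1) =
      oracle θ₀ σ := by
  have hm := measurable_extendZero (supp θ₀)
  rw [gaussianOn, multivariateGaussian, sqrt_scalar, ← map_pi_eq_stdGaussian,
    Measure.map_map hm (by fun_prop), Measure.map_map (hm.comp (by fun_prop)) (by fun_prop), oracle]
  set F : (supp θ₀ → ℝ) → (Fin p → ℝ) := fun x i =>
    if h : i ∈ supp θ₀ then θ₀ i + σ * x ⟨i, h⟩ else 0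
  have hF : (extendZero (supp θ₀) ∘ (fun x => (WithLp.toLp 2 fun i : supp θ₀ => θ₀ i) +
      (Matrix.toEuclideanCLM (𝕜 := ℝ) ((σ : ℝ) • (1 : Matrix (supp θ₀) (supp θ₀) ℝ))) x) ∘
      WithLp.toLp 2) = F := by
    ext x i
    by_cases hi : i ∈ supp θ₀ <;> simp [F, extendZero, hi]
  rw [← Function.comp_assoc] at hF
  rw [hF]
  have hFm : Measurable F := measurable_pi_lambda _ fun i => by
    by_cases hi : i ∈ supp θ₀
    · simp only [F, hi, dif_pos]; fun_prop
    · simp only [F, hi, dif_neg, not_false_eq_true]; fun_prop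
  refine (Measure.pi_eq fun s hs => ?_).symm
  rw [Measure.map_apply hFm (MeasurableSet.univ_pi hs)]
  have hfac : ∀ i ∈ supp θ₀, oracleFactor θ₀ σ i (s i) =
      gaussianReal 0 1 ((fun x => θ₀ i + σ * x) ⁻¹' s i) := fun i hi => by
    have e : gaussianReal (θ₀ i) (σ ^ 2) = (gaussianReal 0 1).map fun x => θ₀ i + σ * x := by
      have h1 := gaussianReal_map_const_mul (μ := 0) (v := 1) (σ : ℝ)
      have h2 := gaussianReal_map_const_add (μ := (σ : ℝ) * 0)
        (v := NNReal.mk ((σ : ℝ) ^ 2) (sq_nonneg _) * 1) (θ₀ i)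
      rw [← h1, Measure.map_map (by fun_prop) (by fun_prop)] at h2
      rw [show (fun x : ℝ => θ₀ i + σ * x) = (θ₀ i + ·) ∘ ((σ : ℝ) * ·) from rfl, h2]
      congr 1
      · simp
      · ext; simp
    rw [oracleFactor, if_pos hi, e, Measure.map_apply (by fun_prop) (hs i)]
  by_cases h0 : ∀ i ∉ supp θ₀, (0 : ℝ) ∈ s i
  · have e : F ⁻¹' Set.univ.pi s =
        Set.univ.pi fun i : supp θ₀ => (fun x => θ₀ i + σ * x) ⁻¹' s i := by
      ext x
      simp only [Set.mem_preimage, Set.mem_pi, Set.mem_univ, true_implies, F]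
      constructor
      · intro h i
        simpa using h i
      · intro h i
        by_cases hi : i ∈ supp θ₀
        · simpa [hi] using h ⟨i, hi⟩
        · simpa [hi] using h0 i hi
    rw [e, Measure.pi_pi, ← Finset.prod_subset (Finset.subset_univ (supp θ₀)),
      ← Finset.prod_coe_sort (supp θ₀) fun i => oracleFactor θ₀ σ i (s i)]
    · exact Finset.prod_congr rfl fun (i : supp θ₀) _ => (hfac i.1 i.2).symm
    · intro i _ hi
      simp [oracleFactor, hi, Measure.dirac_apply' _ (hs i), h0 i hi]
  · push Not at h0
    obtain ⟨i, hi, his⟩ := h0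
    have e : F ⁻¹' Set.univ.pi s = ∅ := by
      ext x
      simp only [Set.mem_preimage, Set.mem_pi, Set.mem_univ, true_implies, Set.mem_empty_iff_false,
        iff_false, not_forall]
      exact ⟨i, by simpa [F, hi] using his⟩
    rw [e, measure_empty]
    refine (Finset.prod_eq_zero (Finset.mem_univ i) ?_).symm
    simp [oracleFactor, hi, Measure.dirac_apply' _ (hs i), his]

lemma oracle_mem_familyQMF (θ₀ : Fin p → ℝ) {σ : ℝ≥0} (hσ : 0 < σ) :
    oracle θ₀ σ ∈ familyQMF p :=
  ⟨supp θ₀, _, _, Matrix.PosDef.one.smul (by positivity : 0 < (σ : ℝ) ^ 2),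
    fun i j hij => by simp [Matrix.one_apply_ne hij], (gaussianOn_eq_oracle θ₀ σ).symm⟩

lemma oracle_mem_familyQ (θ₀ : Fin p → ℝ) {σ : ℝ≥0} (hσ : 0 < σ) : oracle θ₀ σ ∈ familyQ p :=
  let ⟨S, μ, D, h1, _, h3⟩ := oracle_mem_familyQMF θ₀ hσ
  ⟨S, μ, D, h1, h3⟩

/-- The log-density of a Gaussian with respect to a Laplace distribution. -/
noncomputable def logRatio (lam m : ℝ) (σ : ℝ≥0) (x : ℝ) : ℝ :=
  -Real.log √(2 * Real.pi * (σ ^ 2 : ℝ≥0)) - Real.log (lam / 2) + lam * |x|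
    - (x - m) ^ 2 / (2 * (σ ^ 2 : ℝ≥0))

lemma measurable_logRatio (lam m : ℝ) (σ : ℝ≥0) : Measurable (logRatio lam m σ) := by
  unfold logRatio; fun_prop

lemma gaussianReal_eq_withDensity_laplace {lam : ℝ} (hlam : 0 < lam) (m : ℝ) {σ : ℝ≥0}
    (hσ : 0 < σ) :
    gaussianReal m (σ ^ 2) =
      (laplace lam).withDensity fun x => ENNReal.ofReal (Real.exp (logRatio lam m σ x)) := by
  rw [laplace, ← withDensity_mul _ (by fun_prop)
    (by have := measurable_logRatio lam m σ; fun_prop),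
    gaussianReal_of_var_ne_zero _ (by positivity)]
  congr 1
  ext1 x
  rw [Pi.mul_apply, ← ENNReal.ofReal_mul (by positivity), gaussianPDF, gaussianPDFReal]
  congr 1
  have h1 : 0 < √(2 * Real.pi * (σ ^ 2 : ℝ≥0)) := Real.sqrt_pos.2 (by positivity)
  have e : logRatio lam m σ x = lam * |x| + (-Real.log √(2 * Real.pi * (σ ^ 2 : ℝ≥0)) +
      (-Real.log (lam / 2) + -(x - m) ^ 2 / (2 * (σ ^ 2 : ℝ≥0)))) := by
    rw [logRatio]; ring
  rw [e, Real.exp_add, Real.exp_add, Real.exp_add, Real.exp_neg, Real.exp_log h1, Real.exp_neg,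
    Real.exp_log (by positivity), neg_mul, Real.exp_neg]
  field_simp

lemma integrable_sub_sq_gaussianReal (m : ℝ) (v : ℝ≥0) :
    Integrable (fun x => (x - m) ^ 2) (gaussianReal m v) :=
  ((memLp_id_gaussianReal' 2 (by simp)).sub (memLp_const m)).integrable_sq

lemma integral_sub_sq_gaussianReal (m : ℝ) (v : ℝ≥0) :
    ∫ x, (x - m) ^ 2 ∂(gaussianReal m v) = v := by
  have h := variance_fun_id_gaussianReal (μ := m) (v := v)
  rw [variance_eq_integral (by fun_prop)] at h
  simpa using h

lemma integrable_logRatio (lam m : ℝ) (σ : ℝ≥0) :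
    Integrable (logRatio lam m σ) (gaussianReal m (σ ^ 2)) := by
  have h1 : Integrable (fun x : ℝ => |x|) (gaussianReal m (σ ^ 2)) :=
    ((memLp_id_gaussianReal' 1 (by simp)).integrable (by simp)).abs
  exact (((integrable_const _).sub (integrable_const _)).add (h1.const_mul lam)).sub
    ((integrable_sub_sq_gaussianReal m _).div_const _)

lemma integral_logRatio_le {lam : ℝ} (hlam : 0 < lam) (m : ℝ) {σ : ℝ≥0} (hσ : 0 < σ) :
    ∫ x, logRatio lam m σ x ∂(gaussianReal m (σ ^ 2)) ≤
      -Real.log (lam * σ) + lam * |m| + lam * σ := by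
  have hσ' : (0 : ℝ) < σ := hσ
  set k := -Real.log (lam * σ) + lam * |m| + lam * σ / 2 with hk
  have hb : ∀ x, logRatio lam m σ x ≤ k + lam / (2 * σ) * (x - m) ^ 2 := fun x => by
    have h1 : lam * |x| ≤ lam * (|m| + (σ / 2 + (x - m) ^ 2 / (2 * σ))) := by
      gcongr
      have h2 : |x| ≤ |m| + |x - m| := by
        have := abs_add_le m (x - m)
        simpa using this
      have h3 : |x - m| ≤ σ / 2 + (x - m) ^ 2 / (2 * σ) := by
        rw [← sq_abs (x - m)]
        have : σ / 2 + |x - m| ^ 2 / (2 * σ) - |x - m| = (|x - m| - σ) ^ 2 / (2 * σ) := by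
          field_simp; ring
        have h4 : 0 ≤ (|x - m| - σ) ^ 2 / (2 * (σ : ℝ)) := by positivity
        linarith
      linarith
    have h5 : Real.log (lam * σ) ≤
        Real.log √(2 * Real.pi * (σ ^ 2 : ℝ≥0)) + Real.log (lam / 2) := by
      rw [← Real.log_mul (Real.sqrt_pos.2 (by positivity)).ne' (by positivity)]
      refine Real.log_le_log (by positivity) ?_
      have h6 : 2 * (σ : ℝ) ≤ √(2 * Real.pi * (σ ^ 2 : ℝ≥0)) := by
        refine Real.le_sqrt_of_sq_le ?_
        push_cast
        nlinarith [Real.pi_gt_three, sq_nonneg (σ : ℝ)]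
      calc lam * σ = 2 * σ * (lam / 2) := by ring
        _ ≤ _ := by gcongr
    have h7 : 0 ≤ (x - m) ^ 2 / (2 * ((σ ^ 2 : ℝ≥0) : ℝ)) := by positivity
    have h8 : lam * ((x - m) ^ 2 / (2 * σ)) = lam / (2 * σ) * (x - m) ^ 2 := by ring
    rw [logRatio, hk]
    linarith
  have hi := (integrable_sub_sq_gaussianReal m (σ ^ 2)).const_mul (lam / (2 * σ))
  refine (integral_mono (integrable_logRatio lam m σ) ((integrable_const k).add hi) hb).trans_eq ?_
  simp only [Pi.add_apply]
  rw [integral_add (integrable_const _) hi, integral_const_mul, integral_sub_sq_gaussianReal]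
  simp only [integral_const, probReal_univ, smul_eq_mul, one_mul, hk]
  push_cast
  field_simp
  ring

lemma oracle_eq_withDensity_slab {lam : ℝ} (hlam : 0 < lam) (θ₀ : Fin p → ℝ) {σ : ℝ≥0}
    (hσ : 0 < σ) :
    oracle θ₀ σ = (slab lam (supp θ₀)).withDensity fun θ =>
      ENNReal.ofReal (Real.exp (∑ i ∈ supp θ₀, logRatio lam (θ₀ i) σ (θ i))) := by
  have := isProbabilityMeasure_laplace hlam
  have : ∀ i, IsProbabilityMeasure (if i ∈ supp θ₀ then laplace lam else Measure.dirac (0 : ℝ)) :=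
    fun i => isProbabilityMeasure_ite _
  set f : Fin p → ℝ → ℝ≥0∞ := fun i x =>
    ENNReal.ofReal (Real.exp (if i ∈ supp θ₀ then logRatio lam (θ₀ i) σ x else 0)) with hf
  have hfm : ∀ i, Measurable (f i) := fun i => by
    have := measurable_logRatio lam (θ₀ i) σ
    simp only [hf]; split_ifs <;> fun_prop
  have e : ∀ i, oracleFactor θ₀ σ i =
      (if i ∈ supp θ₀ then laplace lam else Measure.dirac (0 : ℝ)).withDensity (f i) := fun i => by
    by_cases hi : i ∈ supp θ₀
    · simp only [oracleFactor, hi, if_true, hf]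
      exact gaussianReal_eq_withDensity_laplace hlam _ hσ
    · simp only [oracleFactor, hi, if_false, hf, Real.exp_zero, ENNReal.ofReal_one]
      exact withDensity_one.symm
  have hsf : ∀ i, SigmaFinite ((if i ∈ supp θ₀ then laplace lam
      else Measure.dirac (0 : ℝ)).withDensity (f i)) := fun i => by rw [← e i]; infer_instance
  rw [oracle, funext e, pi_withDensity _ hfm]
  refine congrArg _ (funext fun θ => ?_)
  simp only [hf]
  rw [← ENNReal.ofReal_prod_of_nonneg fun _ _ => (Real.exp_pos _).le, ← Real.exp_sum]
  rw [Finset.sum_ite_mem, Finset.univ_inter]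

lemma integral_oracle_comp_eval (θ₀ : Fin p → ℝ) (σ : ℝ≥0) {i : Fin p} (hi : i ∈ supp θ₀)
    {f : ℝ → ℝ} (hf : Integrable f (gaussianReal (θ₀ i) (σ ^ 2))) :
    Integrable (fun θ => f (θ i)) (oracle θ₀ σ) ∧
      ∫ θ, f (θ i) ∂(oracle θ₀ σ) = ∫ x, f x ∂(gaussianReal (θ₀ i) (σ ^ 2)) := by
  have e : oracleFactor θ₀ σ i = gaussianReal (θ₀ i) (σ ^ 2) := if_pos hi
  rw [← e] at hf ⊢
  exact ⟨integrable_comp_eval hf, integral_comp_eval hf.aestronglyMeasurable⟩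

lemma integral_sum_logRatio_le {lam : ℝ} (hlam : 0 < lam) (θ₀ : Fin p → ℝ) {σ : ℝ≥0} (hσ : 0 < σ) :
    Integrable (fun θ => ∑ i ∈ supp θ₀, logRatio lam (θ₀ i) σ (θ i)) (oracle θ₀ σ) ∧
    ∫ θ, ∑ i ∈ supp θ₀, logRatio lam (θ₀ i) σ (θ i) ∂(oracle θ₀ σ) ≤
      (supp θ₀).card * (-Real.log (lam * σ) + lam * σ) + lam * l1norm θ₀ := by
  have h := fun i (hi : i ∈ supp θ₀) =>
    integral_oracle_comp_eval θ₀ σ hi (integrable_logRatio lam (θ₀ i) σ)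
  refine ⟨integrable_finsetSum _ fun i hi => (h i hi).1, ?_⟩
  rw [integral_finsetSum _ fun i hi => (h i hi).1]
  calc _ ≤ ∑ i ∈ supp θ₀, ((-Real.log (lam * σ) + lam * σ) + lam * |θ₀ i|) := by
        refine Finset.sum_le_sum fun i hi => ?_
        rw [(h i hi).2]
        linarith [integral_logRatio_le hlam (θ₀ i) hσ]
    _ ≤ _ := by
        rw [Finset.sum_add_distrib, Finset.sum_const, nsmul_eq_mul, ← Finset.mul_sum]
        gcongr
        exact Finset.sum_le_univ_sum_of_nonneg fun _ => abs_nonneg _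

/-! ### The posterior as a tilted prior -/

/-- The log-likelihood ratio of `θ` and `θ₀`, plus the prior penalty at `θ₀`. The second term
compensates the smallness of the prior density near a large `θ₀`. -/
noncomputable def excess (X : Matrix (Fin n) (Fin p) ℝ) (lam : ℝ) (θ₀ : Fin p → ℝ)
    (Y : Fin n → ℝ) (θ : Fin p → ℝ) : ℝ :=
  (Y - X *ᵥ θ₀) ⬝ᵥ (X *ᵥ (θ - θ₀)) - l2norm (X *ᵥ (θ - θ₀)) ^ 2 / 2 + lam * l1norm θ₀

lemma measurable_excess_uncurry (X : Matrix (Fin n) (Fin p) ℝ) (lam : ℝ) (θ₀ : Fin p → ℝ) :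
    Measurable fun q : (Fin n → ℝ) × (Fin p → ℝ) => excess X lam θ₀ q.1 q.2 := by
  simp only [excess, l2norm_sq, dotProduct, Matrix.mulVec, Pi.sub_apply]
  fun_prop

lemma measurable_excess (X : Matrix (Fin n) (Fin p) ℝ) (lam : ℝ) (θ₀ : Fin p → ℝ)
    (Y : Fin n → ℝ) : Measurable (excess X lam θ₀ Y) :=
  (measurable_excess_uncurry X lam θ₀).comp (by fun_prop : Measurable fun θ => (Y, θ))

lemma neg_l2norm_sq_eq_excess (lam : ℝ) (θ₀ : Fin p → ℝ) (Y : Fin n → ℝ) (θ : Fin p → ℝ) :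
    -(l2norm (Y - X *ᵥ θ) ^ 2) / 2 =
      (-(l2norm (Y - X *ᵥ θ₀) ^ 2) / 2 - lam * l1norm θ₀) + excess X lam θ₀ Y θ := by
  have e : Y - X *ᵥ θ = (Y - X *ᵥ θ₀) - X *ᵥ (θ - θ₀) := by
    rw [Matrix.mulVec_sub]; abel
  rw [e, excess]
  generalize Y - X *ᵥ θ₀ = a
  generalize X *ᵥ (θ - θ₀) = b
  simp only [l2norm_sq_eq_dotProduct, sub_dotProduct, dotProduct_sub, dotProduct_comm b a]
  ring

lemma integrable_exp_excess (P : Measure (Fin p → ℝ)) [IsProbabilityMeasure P] (lam : ℝ)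
    (θ₀ : Fin p → ℝ) (Y : Fin n → ℝ) : Integrable (fun θ => Real.exp (excess X lam θ₀ Y θ)) P := by
  refine Integrable.of_bound
    (C := Real.exp (-(-(l2norm (Y - X *ᵥ θ₀) ^ 2) / 2 - lam * l1norm θ₀)))
    (Real.measurable_exp.comp (measurable_excess X lam θ₀ Y)).aestronglyMeasurable
    (ae_of_all _ fun θ => ?_)
  rw [Real.norm_eq_abs, Real.abs_exp, Real.exp_le_exp]
  have h := neg_l2norm_sq_eq_excess (X := X) lam θ₀ Y θ
  have := sq_nonneg (l2norm (Y - X *ᵥ θ))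
  linarith

lemma posterior_eq_tilted (w : ℕ → ℝ) (lam : ℝ) [IsProbabilityMeasure (prior p w lam)]
    (θ₀ : Fin p → ℝ) (Y : Fin n → ℝ) :
    posterior X w lam Y = (prior p w lam).tilted (excess X lam θ₀ Y) := by
  have hi := integrable_exp_excess (X := X) (prior p w lam) lam θ₀ Y
  have hpos := integral_exp_pos hi
  set I := ∫ θ, Real.exp (excess X lam θ₀ Y θ) ∂(prior p w lam)
  set k := -(l2norm (Y - X *ᵥ θ₀) ^ 2) / 2 - lam * l1norm θ₀
  have hL : likelihood X Y = fun θ =>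
      ENNReal.ofReal (Real.exp k * Real.exp (excess X lam θ₀ Y θ)) := by
    ext θ
    rw [likelihood, neg_l2norm_sq_eq_excess lam θ₀, Real.exp_add]
  have hZ : ∫⁻ θ, likelihood X Y θ ∂(prior p w lam) = ENNReal.ofReal (Real.exp k * I) := by
    rw [hL, ← ofReal_integral_eq_lintegral_ofReal (hi.const_mul _)
      (ae_of_all _ fun _ => by positivity), integral_const_mul]
  have hm : Measurable (likelihood X Y) := by
    rw [hL]; have := measurable_excess X lam θ₀ Y; fun_prop
  rw [posterior, hZ, Measure.tilted, ← withDensity_smul _ hm]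
  congr 1
  ext θ
  rw [Pi.smul_apply, hL, smul_eq_mul, ← ENNReal.ofReal_inv_of_pos (by positivity),
    ← ENNReal.ofReal_mul (by positivity)]
  congr 1
  change _ = _ / I
  field_simp

/-- Posterior probabilities as quotients of integrals of the exponential of `excess`. -/
lemma posterior_apply (w : ℕ → ℝ) (lam : ℝ) [IsProbabilityMeasure (prior p w lam)]
    (θ₀ : Fin p → ℝ) (Y : Fin n → ℝ) {E : Set (Fin p → ℝ)} (hE : MeasurableSet E) :
    posterior X w lam Y E =
      (∫⁻ θ in E, ENNReal.ofReal (Real.exp (excess X lam θ₀ Y θ)) ∂(prior p w lam)) /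
        ENNReal.ofReal (∫ θ, Real.exp (excess X lam θ₀ Y θ) ∂(prior p w lam)) := by
  have hpos := integral_exp_pos (integrable_exp_excess (X := X) (prior p w lam) lam θ₀ Y)
  rw [posterior_eq_tilted w lam θ₀ Y, tilted_apply' _ _ hE]
  simp_rw [ENNReal.ofReal_div_of_pos hpos, div_eq_mul_inv]
  rw [lintegral_mul_const]
  have := measurable_excess X lam θ₀ Y
  fun_prop

lemma isProbabilityMeasure_posterior (w : ℕ → ℝ) (lam : ℝ) [IsProbabilityMeasure (prior p w lam)]
    (Y : Fin n → ℝ) : IsProbabilityMeasure (posterior X w lam Y) := by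
  rw [posterior_eq_tilted w lam 0 Y]
  exact isProbabilityMeasure_tilted (integrable_exp_excess _ _ _ _)

/-! ### The divergence of the competitor from the posterior -/

lemma moments_oracleFactor (θ₀ : Fin p → ℝ) (σ : ℝ≥0) (i : Fin p) (c : ℝ) :
    MemLp (fun x => c * (x - θ₀ i)) 2 (oracleFactor θ₀ σ i) ∧
    ∫ x, c * (x - θ₀ i) ∂(oracleFactor θ₀ σ i) = 0 ∧
    Var[fun x => c * (x - θ₀ i); oracleFactor θ₀ σ i] ≤
      if i ∈ supp θ₀ then c ^ 2 * σ ^ 2 else 0 := by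
  by_cases hi : i ∈ supp θ₀
  · have hL : MemLp (fun x => c * (x - θ₀ i)) 2 (gaussianReal (θ₀ i) (σ ^ 2)) :=
      ((memLp_id_gaussianReal' 2 (by simp)).sub (memLp_const _)).const_mul c
    have h0 : ∫ x, c * (x - θ₀ i) ∂(gaussianReal (θ₀ i) (σ ^ 2)) = 0 := by
      have hid : Integrable (fun x : ℝ => x) (gaussianReal (θ₀ i) (σ ^ 2)) :=
        (memLp_id_gaussianReal' 1 (by simp)).integrable (by simp)
      rw [integral_const_mul, integral_sub hid (integrable_const _)]
      simp
    simp only [oracleFactor, hi, if_true]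
    refine ⟨hL, h0, ?_⟩
    rw [variance_of_integral_eq_zero hL.aestronglyMeasurable.aemeasurable h0]
    simp only [mul_pow]
    rw [integral_const_mul, integral_sub_sq_gaussianReal]
    simp
  · have h0 : θ₀ i = 0 := by simpa [mem_supp] using hi
    simp only [oracleFactor, hi, if_false, h0, sub_zero]
    have hm : ∫ x, c * x ∂(Measure.dirac (0 : ℝ)) = 0 := by rw [integral_dirac]; simp
    have e : (fun x => c * x) =ᵐ[Measure.dirac (0 : ℝ)] fun _ => 0 := by
      rw [Filter.EventuallyEq, ae_dirac_eq]; simp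
    refine ⟨(memLp_congr_ae e).2 (memLp_const 0), hm, ?_⟩
    rw [variance_congr e]; simp

lemma moments_mulVec_oracle (X : Matrix (Fin n) (Fin p) ℝ) (θ₀ : Fin p → ℝ) (σ : ℝ≥0)
    (j : Fin n) :
    MemLp (fun θ => (X *ᵥ (θ - θ₀)) j) 2 (oracle θ₀ σ) ∧
    ∫ θ, (X *ᵥ (θ - θ₀)) j ∂(oracle θ₀ σ) = 0 ∧
    ∫ θ, (X *ᵥ (θ - θ₀)) j ^ 2 ∂(oracle θ₀ σ) ≤ ∑ i ∈ supp θ₀, X j i ^ 2 * σ ^ 2 := by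
  have hc := fun i => moments_oracleFactor θ₀ σ i (X j i)
  have e : (fun θ : Fin p → ℝ => (X *ᵥ (θ - θ₀)) j) =
      ∑ i, fun θ : Fin p → ℝ => X j i * (θ i - θ₀ i) := by
    ext θ; simp [Matrix.mulVec, dotProduct]
  have hL : ∀ i, MemLp (fun θ : Fin p → ℝ => X j i * (θ i - θ₀ i)) 2 (oracle θ₀ σ) := fun i =>
    (hc i).1.comp_measurePreserving (measurePreserving_eval (oracleFactor θ₀ σ) i)
  have h1 : MemLp (fun θ => (X *ᵥ (θ - θ₀)) j) 2 (oracle θ₀ σ) := by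
    rw [e]; exact memLp_finsetSum' _ fun i _ => hL i
  have h2 : ∫ θ, (X *ᵥ (θ - θ₀)) j ∂(oracle θ₀ σ) = 0 := by
    have e' : ∀ θ : Fin p → ℝ, (X *ᵥ (θ - θ₀)) j = ∑ i, X j i * (θ i - θ₀ i) := fun _ => rfl
    simp_rw [e']
    rw [integral_finsetSum _ fun i _ => (hL i).integrable one_le_two]
    refine Finset.sum_eq_zero fun i _ => ?_
    rw [← (hc i).2.1]
    exact integral_comp_eval (μ := oracleFactor θ₀ σ) (i := i)
      (f := fun x => X j i * (x - θ₀ i)) (hc i).1.aestronglyMeasurable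
  refine ⟨h1, h2, ?_⟩
  rw [← variance_of_integral_eq_zero h1.aestronglyMeasurable.aemeasurable h2, e, oracle,
    variance_sum_pi (X := fun i x => X j i * (x - θ₀ i)) fun i => (hc i).1]
  refine (Finset.sum_le_sum fun i _ => (hc i).2.2).trans_eq ?_
  rw [Finset.sum_ite_mem, Finset.univ_inter]

lemma integral_excess_oracle (X : Matrix (Fin n) (Fin p) ℝ) (lam : ℝ) (θ₀ : Fin p → ℝ) (σ : ℝ≥0)
    (Y : Fin n → ℝ) :
    Integrable (excess X lam θ₀ Y) (oracle θ₀ σ) ∧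
    lam * l1norm θ₀ - (supp θ₀).card * (colNorm X ^ 2 * σ ^ 2) / 2 ≤
      ∫ θ, excess X lam θ₀ Y θ ∂(oracle θ₀ σ) := by
  have hW := moments_mulVec_oracle X θ₀ σ
  set z := Y - X *ᵥ θ₀ with hz
  have i1 : Integrable (fun θ => z ⬝ᵥ (X *ᵥ (θ - θ₀))) (oracle θ₀ σ) :=
    integrable_finsetSum _ fun j _ => ((hW j).1.integrable one_le_two).const_mul _
  have e1 : ∫ θ, z ⬝ᵥ (X *ᵥ (θ - θ₀)) ∂(oracle θ₀ σ) = 0 := by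
    simp only [dotProduct]
    rw [integral_finsetSum _ fun j _ => ((hW j).1.integrable one_le_two).const_mul _]
    exact Finset.sum_eq_zero fun j _ => by rw [integral_const_mul, (hW j).2.1, mul_zero]
  have i2 : Integrable (fun θ => l2norm (X *ᵥ (θ - θ₀)) ^ 2) (oracle θ₀ σ) := by
    simp only [l2norm_sq]
    exact integrable_finsetSum _ fun j _ => (hW j).1.integrable_sq
  have e2 : ∫ θ, l2norm (X *ᵥ (θ - θ₀)) ^ 2 ∂(oracle θ₀ σ) ≤
      (supp θ₀).card * (colNorm X ^ 2 * σ ^ 2) := by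
    simp only [l2norm_sq]
    rw [integral_finsetSum _ fun j _ => (hW j).1.integrable_sq]
    refine (Finset.sum_le_sum fun j _ => (hW j).2.2).trans ?_
    rw [Finset.sum_comm, ← nsmul_eq_mul]
    refine Finset.sum_le_card_nsmul _ _ _ fun i _ => ?_
    rw [← Finset.sum_mul]
    refine mul_le_mul_of_nonneg_right ?_ (by positivity)
    have h := pow_le_pow_left₀ (l2norm_nonneg _) (l2norm_col_le X i) 2
    rwa [l2norm_sq] at h
  refine ⟨(i1.sub (i2.div_const 2)).add (integrable_const _), ?_⟩
  have e3 : ∫ θ, excess X lam θ₀ Y θ ∂(oracle θ₀ σ) =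
      0 - (∫ θ, l2norm (X *ᵥ (θ - θ₀)) ^ 2 ∂(oracle θ₀ σ)) / 2 + lam * l1norm θ₀ := by
    simp only [excess, ← hz]
    have i3 : Integrable (fun θ => z ⬝ᵥ (X *ᵥ (θ - θ₀)) - l2norm (X *ᵥ (θ - θ₀)) ^ 2 / 2)
        (oracle θ₀ σ) := i1.sub (i2.div_const 2)
    rw [integral_add i3 (integrable_const _),
      integral_sub i1 (i2.div_const 2), e1, integral_div]
    simp
  rw [e3]
  linarith

variable {A₁ A₂ A₃ A₄ : ℝ} {w : ℕ → ℝ} {lam : ℝ}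

/-- The divergence of the competitor from the posterior in terms of the normalizing integral. The
penalty `lam * ‖θ₀‖₁` in the divergence from the prior cancels against that in `excess`.
Nonnegativity of the divergence yields a lower bound on the normalizing integral. -/
lemma klDiv_oracle_posterior_le (h : PriorCond A₁ A₂ A₃ A₄ X w lam) (θ₀ : Fin p → ℝ) {σ : ℝ≥0}
    (hσ : 0 < σ) (hw : 0 < w (supp θ₀).card) {b : ℝ}
    (hb : (supp θ₀).card * (-Real.log (lam * σ) + lam * σ)
      + (supp θ₀).card * (colNorm X ^ 2 * σ ^ 2) / 2
      - Real.log (w (supp θ₀).card / (p.choose (supp θ₀).card : ℝ)) ≤ b) (Y : Fin n → ℝ) :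
    0 ≤ b + Real.log (∫ θ, Real.exp (excess X lam θ₀ Y θ) ∂(prior p w lam)) ∧
    klDiv (oracle θ₀ σ) (posterior X w lam Y) ≤
      ENNReal.ofReal (b + Real.log (∫ θ, Real.exp (excess X lam θ₀ Y θ) ∂(prior p w lam))) := by
  have := isProbabilityMeasure_prior h
  have := isProbabilityMeasure_slab h.lam_pos (supp θ₀)
  have hch : (0 : ℝ) < p.choose (supp θ₀).card := by
    exact_mod_cast Nat.choose_pos (by simpa using (supp θ₀).card_le_univ)
  obtain ⟨hGi, hG⟩ := integral_sum_logRatio_le h.lam_pos θ₀ hσ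
  have hGm : Measurable fun θ : Fin p → ℝ =>
      ∑ i ∈ supp θ₀, logRatio lam (θ₀ i) σ (θ i) :=
    Finset.measurable_sum _ fun i _ =>
      (measurable_logRatio lam (θ₀ i) σ).comp (measurable_pi_apply i)
  obtain ⟨hac, hllr, hint⟩ := llr_le_of_smul_le hGm (oracle_eq_withDensity_slab h.lam_pos θ₀ hσ)
    (by positivity : 0 < w (supp θ₀).card / (p.choose (supp θ₀).card : ℝ))
    (smul_slab_le_prior w lam (supp θ₀)) hGi
  obtain ⟨hei, he⟩ := integral_excess_oracle X lam θ₀ σ Y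
  have hexp := integrable_exp_excess (X := X) (prior p w lam) lam θ₀ Y
  have hprob := isProbabilityMeasure_posterior (X := X) w lam Y
  rw [posterior_eq_tilted w lam θ₀ Y] at hprob ⊢
  have hac' := hac.trans (absolutelyContinuous_tilted hexp)
  have hllr' := integrable_llr_tilted_right hac hei hllr hexp
  have hv := integral_llr_tilted_right hac hei hexp hllr
  have hnn := integral_llr_add_sub_measure_univ_nonneg hac' hllr'
  simp only [probReal_univ] at hnn
  constructor
  · linarith
  · rw [klDiv_of_ac_of_integrable hac' hllr']
    refine ENNReal.ofReal_le_ofReal ?_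
    simp only [probReal_univ]
    linarith

/-- The deterministic part of the divergence of the competitor with standard deviation `‖X‖⁻¹` is of
order `s log p`: each of the `s` active coordinates costs at most `5 log p`, and the prior
probability of a model of dimension `s` is at least a power of `p⁻ˢ`. -/
lemma oracle_bound (h : PriorCond A₁ A₂ A₃ A₄ X w lam) (hA₁ : 0 < A₁)
    (hlog : 1 ≤ Real.log p) (hw0 : 1 / 2 ≤ w 0) {s : ℕ} (hs : 1 ≤ s) (hsp : s ≤ p) {σ : ℝ}
    (hσ : σ = (colNorm X)⁻¹) :
    0 < w s ∧ s * (-Real.log (lam * σ) + lam * σ) + s * (colNorm X ^ 2 * σ ^ 2) / 2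
      - Real.log (w s / (p.choose s : ℝ)) ≤ (8 + |Real.log A₁| + A₃) * (s * Real.log p) := by
  have hX := h.colNorm_pos
  have hlam := h.lam_pos
  have hp0 : (0 : ℝ) < p := by exact_mod_cast (by lia : 0 < p)
  have hs1 : (1 : ℝ) ≤ s := by exact_mod_cast hs
  have hch : (0 : ℝ) < p.choose s := by exact_mod_cast Nat.choose_pos hsp
  set L := Real.log p
  have hwl := h.le_weight hA₁ s hsp
  have hq : 0 < A₁ * (p : ℝ) ^ (-A₃) := by positivity
  have hlow : (A₁ * (p : ℝ) ^ (-A₃)) ^ s * (1 / 2) ≤ w s :=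
    (mul_le_mul_of_nonneg_left hw0 (by positivity)).trans hwl
  have hw : 0 < w s := lt_of_lt_of_le (by positivity) hlow
  refine ⟨hw, ?_⟩
  have h1 : -L ≤ Real.log (lam * σ) := by
    rw [← Real.log_inv]
    refine Real.log_le_log (by positivity) ?_
    rw [hσ, ← div_eq_mul_inv, le_div_iff₀ hX, inv_mul_eq_div]
    exact h.lam_lower
  have h2 : lam * σ ≤ 4 * L := by
    have h3 : √L ≤ L := Real.sqrt_le_iff.2 ⟨by linarith, by nlinarith⟩
    have h4 := h.lam_upper
    rw [lamBar] at h4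
    rw [hσ, ← div_eq_mul_inv, div_le_iff₀ hX]
    calc lam ≤ 4 * √L * colNorm X := by linarith
      _ ≤ _ := by gcongr
  have h3 : colNorm X ^ 2 * σ ^ 2 = 1 := by rw [hσ]; field_simp
  have h4 : Real.log (p.choose s) ≤ s * L := by
    rw [← Real.log_pow]
    exact Real.log_le_log hch (by exact_mod_cast Nat.choose_le_pow p s)
  have h5 : s * (Real.log A₁ - A₃ * L) - Real.log 2 ≤ Real.log (w s) := by
    have := Real.log_le_log (by positivity) hlow
    rw [Real.log_mul (by positivity) (by norm_num), Real.log_pow,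
      Real.log_mul hA₁.ne' (by positivity), Real.log_rpow hp0, one_div, Real.log_inv] at this
    linarith
  rw [Real.log_div hw.ne' hch.ne', h3]
  have h6 : Real.log 2 ≤ 1 := by have := Real.log_two_lt_d9; linarith
  have h7 : (s : ℝ) ≤ s * L := le_mul_of_one_le_right (by linarith) hlog
  have h8 : -(s * Real.log A₁) ≤ |Real.log A₁| * (s * L) := by
    have h9 := neg_abs_le (Real.log A₁)
    have h10 := mul_le_mul_of_nonneg_left h9 (by linarith : (0 : ℝ) ≤ s)
    have h11 := mul_le_mul_of_nonneg_left h7 (abs_nonneg (Real.log A₁))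
    linarith
  have h9 : (s : ℝ) * (-Real.log (lam * σ) + lam * σ) ≤ s * (5 * L) := by
    gcongr; linarith
  linarith

/-! ### Posterior numerators -/

/-- The numerator in Bayes' formula for the event that the model has dimension at least `R`. -/
noncomputable def numer (X : Matrix (Fin n) (Fin p) ℝ) (w : ℕ → ℝ) (lam : ℝ) (θ₀ : Fin p → ℝ)
    (R : ℕ) (Y : Fin n → ℝ) : ℝ≥0∞ :=
  ∫⁻ θ in {θ | R ≤ (supp θ).card}, ENNReal.ofReal (Real.exp (excess X lam θ₀ Y θ)) ∂(prior p w lam)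

lemma measurableSet_le_card_supp (R : ℕ) : MeasurableSet {θ : Fin p → ℝ | R ≤ (supp θ).card} :=
  measurableSet_le measurable_const measurable_card_supp

lemma measurable_numer [IsProbabilityMeasure (prior p w lam)] (θ₀ : Fin p → ℝ) (R : ℕ) :
    Measurable (numer X w lam θ₀ R) := by
  have h := measurable_excess_uncurry X lam θ₀
  exact Measurable.lintegral_prod_right' (f := fun q : (Fin n → ℝ) × (Fin p → ℝ) =>
    ENNReal.ofReal (Real.exp (excess X lam θ₀ q.1 q.2))) (by fun_prop)

lemma numer_zero [IsProbabilityMeasure (prior p w lam)] (θ₀ : Fin p → ℝ) (Y : Fin n → ℝ) :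
    numer X w lam θ₀ 0 Y =
      ENNReal.ofReal (∫ θ, Real.exp (excess X lam θ₀ Y θ) ∂(prior p w lam)) := by
  rw [ofReal_integral_eq_lintegral_ofReal (integrable_exp_excess _ _ _ _)
    (ae_of_all _ fun _ => (Real.exp_pos _).le), numer]
  simp

/-- On the noise event, the part `lam / (2 lamBar)` of the noise term is bounded by half of the
prior penalty; the rest has a small exponential moment, which leaves a negative multiple of the
quadratic form. -/
lemma lintegral_exp_excess_le (h : PriorCond A₁ A₂ A₃ A₄ X w lam) {θ₀ : Fin p → ℝ}
    (hφ : 0 < compat X (supp θ₀)) (θ : Fin p → ℝ) :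
    ∫⁻ Y in noiseEvent X θ₀ (lamBar X), ENNReal.ofReal (Real.exp (excess X lam θ₀ Y θ))
        ∂(dataLaw X θ₀) ≤
      ENNReal.ofReal (Real.exp (49 / 16 *
          (lam * lamBar X * (supp θ₀).card / (colNorm X ^ 2 * compat X (supp θ₀) ^ 2)))) *
        ENNReal.ofReal (Real.exp (lam * l1norm θ - lam / 4 * l1norm (θ - θ₀))) := by
  have hlb := h.lamBar_pos
  have hlam := h.lam_pos
  have hpen := penalty_le h.colNorm_pos hlam hlb hφ θ
  set t := 49 / 16 * (lam * lamBar X * (supp θ₀).card / (colNorm X ^ 2 * compat X (supp θ₀) ^ 2))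
  set u := X *ᵥ (θ - θ₀)
  set a := lam / (2 * lamBar X) with ha
  have ha0 : 0 < a := by positivity
  have ha1 : a ≤ 1 := by rw [ha, div_le_one (by positivity)]; exact h.lam_upper
  have hal : a * lamBar X = lam / 2 := by rw [ha]; field_simp
  have ha4 : lam / (4 * lamBar X) = a / 2 := by rw [ha]; field_simp; norm_num
  set k := lam / 2 * l1norm (θ - θ₀) - l2norm u ^ 2 / 2 + lam * l1norm θ₀
  have h1 : ∀ Y ∈ noiseEvent X θ₀ (lamBar X), ENNReal.ofReal (Real.exp (excess X lam θ₀ Y θ)) ≤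
      ENNReal.ofReal (Real.exp k) *
        ENNReal.ofReal (Real.exp (((1 - a) • u) ⬝ᵥ (Y - X *ᵥ θ₀))) := fun Y hY => by
    rw [← ENNReal.ofReal_mul (Real.exp_pos _).le, ← Real.exp_add]
    refine ENNReal.ofReal_le_ofReal (Real.exp_le_exp.2 ?_)
    have h2 := mul_le_mul_of_nonneg_left (dotProduct_mulVec_le hY (θ - θ₀)) ha0.le
    rw [← mul_assoc, hal] at h2
    change a * ((Y - X *ᵥ θ₀) ⬝ᵥ u) ≤ _ at h2
    rw [smul_dotProduct, smul_eq_mul, dotProduct_comm u]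
    change (Y - X *ᵥ θ₀) ⬝ᵥ u - l2norm u ^ 2 / 2 + lam * l1norm θ₀ ≤
      lam / 2 * l1norm (θ - θ₀) - l2norm u ^ 2 / 2 + lam * l1norm θ₀ + _
    linarith
  have hv : l2norm ((1 - a) • u) ^ 2 = (1 - a) ^ 2 * l2norm u ^ 2 := by
    simp [l2norm_sq, mul_pow, Finset.mul_sum]
  refine (setLIntegral_mono' (measurableSet_noiseEvent X θ₀ _) h1).trans
    ((setLIntegral_le_lintegral _ _).trans ?_)
  rw [lintegral_const_mul' _ _ (by simp), lintegral_exp_noise, hv,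
    ← ENNReal.ofReal_mul (Real.exp_pos _).le, ← ENNReal.ofReal_mul (Real.exp_pos _).le,
    ← Real.exp_add, ← Real.exp_add]
  refine ENNReal.ofReal_le_ofReal (Real.exp_le_exp.2 ?_)
  rw [ha4] at hpen
  have h3 : (1 - a) ^ 2 * l2norm u ^ 2 / 2 - l2norm u ^ 2 / 2 ≤ -(a / 2 * l2norm u ^ 2) := by
    have : 0 ≤ a * (1 - a) * l2norm u ^ 2 :=
      mul_nonneg (mul_nonneg ha0.le (by linarith)) (sq_nonneg _)
    linarith
  simp only [k]
  linarith

lemma lintegral_numer_le (h : PriorCond A₁ A₂ A₃ A₄ X w lam) (hA₂ : 0 < A₂)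
    (hq : 4 * (A₂ * (p : ℝ) ^ (-A₄)) ≤ 1 / 2) {θ₀ : Fin p → ℝ}
    (hφ : 0 < compat X (supp θ₀)) (R : ℕ) :
    ∫⁻ Y in noiseEvent X θ₀ (lamBar X), numer X w lam θ₀ R Y ∂(dataLaw X θ₀) ≤
      ENNReal.ofReal (Real.exp (49 / 16 *
          (lam * lamBar X * (supp θ₀).card / (colNorm X ^ 2 * compat X (supp θ₀) ^ 2))) *
        (2 * (4 * (A₂ * (p : ℝ) ^ (-A₄))) ^ R)) := by
  have := isProbabilityMeasure_prior h
  have hm := measurable_excess_uncurry X lam θ₀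
  simp only [numer]
  rw [lintegral_lintegral_swap (by unfold Function.uncurry; fun_prop)]
  refine (lintegral_mono fun θ => lintegral_exp_excess_le h hφ θ).trans ?_
  rw [lintegral_const_mul' _ _ (by simp), ENNReal.ofReal_mul (Real.exp_pos _).le]
  exact mul_le_mul_right (lintegral_prior_le h hA₂ hq θ₀ R) _

/-- Markov's inequality on an event. -/
lemma measure_inter_lt_le {Ω : Type*} [MeasurableSpace Ω] (P : Measure Ω) {T : Set Ω}
    {f : Ω → ℝ≥0∞} (hf : Measurable f) {x y : ℝ} (hy : 0 < y)
    (h : ∫⁻ ω in T, f ω ∂P ≤ ENNReal.ofReal x) :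
    P (T ∩ {ω | ENNReal.ofReal y < f ω}) ≤ ENNReal.ofReal (x / y) := by
  have h1 := (mul_meas_ge_le_lintegral (μ := P.restrict T) hf (ENNReal.ofReal y)).trans h
  rw [Measure.restrict_apply (measurableSet_le measurable_const hf)] at h1
  rw [ENNReal.ofReal_div_of_pos hy, ENNReal.le_div_iff_mul_le (by simp [hy]) (by simp), mul_comm]
  have h2 : T ∩ {ω | ENNReal.ofReal y < f ω} ⊆ {ω | ENNReal.ofReal y ≤ f ω} ∩ T := by
    rintro ω ⟨h3, h4⟩
    rw [Set.mem_ofPred_eq] at h4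
    exact ⟨h4.le, h3⟩
  exact (mul_le_mul_right (measure_mono h2) _).trans h1

/-! ### Deviation sets -/

/-- A threshold for the prediction error, of the order of the rate. The constant `392 = 8 * 49`
makes an eighth of its square exceed the compatibility term in `l1norm_le_quadratic`, if `D` is the
constant in the bound on the inflated dimension. -/
noncomputable def radius (X : Matrix (Fin n) (Fin p) ℝ) (lam A₄ ρ D : ℝ) (S : Finset (Fin p)) : ℝ :=
  √392 * √D * (√ρ * √(S.card * Real.log p)) / (psiBar X lam A₄ ρ S * compat X S)

/-- The compatibility term in the inflated dimension `(2 + (4 ρ / A₄) (1 + slack)) |S|`. -/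
noncomputable def slack (X : Matrix (Fin n) (Fin p) ℝ) (lam : ℝ) (S : Finset (Fin p)) : ℝ :=
  16 / compat X S ^ 2 * (lam / lamBar X)

/-- A threshold for the dimension of a model: below it, differences with a vector supported on `S`
have at most the inflated dimension. -/
noncomputable def dimBound (X : Matrix (Fin n) (Fin p) ℝ) (lam A₄ ρ : ℝ) (S : Finset (Fin p)) : ℕ :=
  ⌈4 * ρ / A₄ * (1 + slack X lam S) * S.card⌉₊

/-- Parameters of high dimension or with a large prediction error. -/
def badSet (X : Matrix (Fin n) (Fin p) ℝ) (lam A₄ ρ D : ℝ) (θ₀ : Fin p → ℝ) :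
    Set (Fin p → ℝ) :=
  {θ | dimBound X lam A₄ ρ (supp θ₀) ≤ (supp θ).card} ∪
    {θ | radius X lam A₄ ρ D (supp θ₀) ≤ l2norm (X *ᵥ (θ - θ₀))}

lemma measurable_predictionError (X : Matrix (Fin n) (Fin p) ℝ) (θ₀ : Fin p → ℝ) :
    Measurable fun θ => l2norm (X *ᵥ (θ - θ₀)) := by
  simp only [l2norm, dotProduct, Matrix.mulVec, Pi.sub_apply]
  fun_prop

lemma measurableSet_badSet (lam A₄ ρ D : ℝ) (θ₀ : Fin p → ℝ) :
    MeasurableSet (badSet X lam A₄ ρ D θ₀) :=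
  (measurableSet_le_card_supp _).union
    (measurableSet_le measurable_const (measurable_predictionError X θ₀))

lemma slack_nonneg (h : PriorCond A₁ A₂ A₃ A₄ X w lam) (S : Finset (Fin p)) :
    0 ≤ slack X lam S := by
  have := h.lamBar_pos
  have := h.lam_pos
  unfold slack; positivity

lemma slack_le (h : PriorCond A₁ A₂ A₃ A₄ X w lam) (S : Finset (Fin p)) :
    slack X lam S ≤ 32 / compat X S ^ 2 := by
  have h1 := h.lamBar_pos
  have h2 : lam / lamBar X ≤ 2 := by rw [div_le_iff₀ h1]; exact h.lam_upper
  calc slack X lam S ≤ 16 / compat X S ^ 2 * 2 := by unfold slack; gcongr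
    _ = _ := by ring

lemma inflatedDim_eq (lam ρ : ℝ) (S : Finset (Fin p)) :
    inflatedDim X lam A₄ ρ S = (2 + 4 * ρ / A₄ * (1 + slack X lam S)) * S.card := rfl

/-- The assumptions on the truth that are used for a fixed design. -/
structure Regular (X : Matrix (Fin n) (Fin p) ℝ) (lam A₄ ρ : ℝ) (θ₀ : Fin p → ℝ) : Prop where
  ne_zero : θ₀ ≠ 0
  compat_pos : 0 < compat X (supp θ₀)
  psiTilde_pos : 0 < psiTilde X lam A₄ ρ (supp θ₀)
  one_le : 1 ≤ ρ
  one_le_log : 1 ≤ Real.log p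

section Regular

variable {ρ : ℝ} {θ₀ : Fin p → ℝ}

lemma Regular.supp_nonempty (hr : Regular X lam A₄ ρ θ₀) : (supp θ₀).Nonempty :=
  Finset.nonempty_iff_ne_empty.2 fun h => hr.ne_zero (supp_eq_empty_iff.1 h)

lemma Regular.one_le_card (hr : Regular X lam A₄ ρ θ₀) : (1 : ℝ) ≤ (supp θ₀).card := by
  exact_mod_cast Finset.card_pos.2 hr.supp_nonempty

lemma Regular.one_le_inflatedDim (hr : Regular X lam A₄ ρ θ₀)
    (h : PriorCond A₁ A₂ A₃ A₄ X w lam) (hA₄ : 0 < A₄) :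
    1 ≤ inflatedDim X lam A₄ ρ (supp θ₀) := by
  have h1 := slack_nonneg h (supp θ₀)
  have h2 := hr.one_le_card
  have h3 := hr.one_le
  rw [inflatedDim_eq]
  have : 0 ≤ 4 * ρ / A₄ * (1 + slack X lam (supp θ₀)) := by positivity
  nlinarith

lemma Regular.psiTilde_le_psiBar (hr : Regular X lam A₄ ρ θ₀)
    (h : PriorCond A₁ A₂ A₃ A₄ X w lam) (hA₄ : 0 < A₄) :
    psiTilde X lam A₄ ρ (supp θ₀) ≤ psiBar X lam A₄ ρ (supp θ₀) :=
  sparseSing_le_unifCompat h.colNorm_pos hr.supp_nonempty.choose (hr.one_le_inflatedDim h hA₄)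

lemma Regular.psiBar_pos (hr : Regular X lam A₄ ρ θ₀)
    (h : PriorCond A₁ A₂ A₃ A₄ X w lam) (hA₄ : 0 < A₄) :
    0 < psiBar X lam A₄ ρ (supp θ₀) :=
  hr.psiTilde_pos.trans_le (hr.psiTilde_le_psiBar h hA₄)

lemma Regular.psiBar_le_one (hr : Regular X lam A₄ ρ θ₀)
    (h : PriorCond A₁ A₂ A₃ A₄ X w lam) (hA₄ : 0 < A₄) :
    psiBar X lam A₄ ρ (supp θ₀) ≤ 1 :=
  unifCompat_le_one h.colNorm_pos hr.supp_nonempty.choose (hr.one_le_inflatedDim h hA₄)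

/-- The inflated dimension is of order `ρ |S| / φ(S)²`, because `φ(S) ≤ 1`. -/
lemma Regular.inflatedDim_le (hr : Regular X lam A₄ ρ θ₀)
    (h : PriorCond A₁ A₂ A₃ A₄ X w lam) (hA₄ : 0 < A₄) :
    inflatedDim X lam A₄ ρ (supp θ₀) ≤
      (2 + 132 / A₄) * ρ * (supp θ₀).card / compat X (supp θ₀) ^ 2 := by
  have h1 := slack_le h (supp θ₀)
  have h3 := hr.one_le
  have hφ := hr.compat_pos
  have hφ1 := compat_le_one h.colNorm_pos hr.supp_nonempty
  set φ := compat X (supp θ₀)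
  have h4 : 1 ≤ 1 / φ ^ 2 := by
    rw [le_div_iff₀ (by positivity), one_mul]; exact pow_le_one₀ hφ.le hφ1
  have h5 : 1 + slack X lam (supp θ₀) ≤ 33 * (1 / φ ^ 2) := by
    have : 32 / φ ^ 2 = 32 * (1 / φ ^ 2) := by ring
    linarith
  have h6 : (2 : ℝ) ≤ 2 * ρ * (1 / φ ^ 2) := by nlinarith
  have h7 : 4 * ρ / A₄ * (1 + slack X lam (supp θ₀)) ≤ 4 * ρ / A₄ * (33 * (1 / φ ^ 2)) := by gcongr
  rw [inflatedDim_eq]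
  calc _ ≤ (2 * ρ * (1 / φ ^ 2) + 4 * ρ / A₄ * (33 * (1 / φ ^ 2))) * (supp θ₀).card := by gcongr
    _ = _ := by ring

lemma Regular.card_supp_sub_le (hr : Regular X lam A₄ ρ θ₀) {θ : Fin p → ℝ}
    (hθ : (supp θ).card < dimBound X lam A₄ ρ (supp θ₀)) :
    ((supp (θ - θ₀)).card : ℝ) ≤ inflatedDim X lam A₄ ρ (supp θ₀) := by
  have h1 := Nat.lt_ceil.1 hθ
  have h2 : ((supp (θ - θ₀)).card : ℝ) ≤ (supp θ).card + (supp θ₀).card := by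
    exact_mod_cast SparseVB.card_supp_sub_le θ θ₀
  have h3 := hr.one_le_card
  rw [inflatedDim_eq]
  linarith

lemma Regular.losses_le (hr : Regular X lam A₄ ρ θ₀) (h : PriorCond A₁ A₂ A₃ A₄ X w lam)
    (hA₄ : 0 < A₄) {D M : ℝ} (hD : D = 2 + 132 / A₄) (hM : M = √392 * D) {θ : Fin p → ℝ}
    (hθ : θ ∉ badSet X lam A₄ ρ D θ₀) :
    l2norm (X *ᵥ (θ - θ₀)) < M * √ρ / psiBar X lam A₄ ρ (supp θ₀) *
        (√((supp θ₀).card * Real.log p) / compat X (supp θ₀)) ∧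
    l1norm (θ - θ₀) ≤ M * ρ / psiBar X lam A₄ ρ (supp θ₀) ^ 2 *
        ((supp θ₀).card * √(Real.log p) / (colNorm X * compat X (supp θ₀) ^ 2)) ∧
    l2norm (θ - θ₀) ≤ M * √ρ / (colNorm X * psiTilde X lam A₄ ρ (supp θ₀) ^ 2) *
        (√((supp θ₀).card * Real.log p) / compat X (supp θ₀)) := by
  simp only [badSet, Set.mem_union, Set.mem_ofPred_eq, not_or, not_le] at hθ
  have hd := hr.card_supp_sub_le hθ.1
  have hN := hθ.2
  have hψ := hr.psiBar_pos h hA₄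
  have hψt := hr.psiTilde_pos
  have hψl := hr.psiTilde_le_psiBar h hA₄
  have hφ := hr.compat_pos
  have hX := h.colNorm_pos
  have hρ := hr.one_le
  have hl1 := l1norm_le_of_unifCompat hX hψ hd
  have hl2 := l2norm_le_of_sparseSing hX hψt hd
  have hdim := hr.inflatedDim_le h hA₄
  rw [← hD] at hdim
  change l1norm (θ - θ₀) ≤ _ / (colNorm X * psiBar X lam A₄ ρ (supp θ₀)) at hl1
  change l2norm (θ - θ₀) ≤ _ / (colNorm X * psiTilde X lam A₄ ρ (supp θ₀)) at hl2
  rw [radius] at hN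
  have hlog : (0 : ℝ) ≤ Real.log p := by linarith [hr.one_le_log]
  have hD1 : 1 ≤ D := by
    have : 0 ≤ 132 / A₄ := by positivity
    linarith
  set ψ := psiBar X lam A₄ ρ (supp θ₀)
  set ψt := psiTilde X lam A₄ ρ (supp θ₀)
  set φ := compat X (supp θ₀)
  set s : ℝ := ((supp θ₀).card : ℝ)
  have hs : 0 ≤ s := Nat.cast_nonneg _
  set c := colNorm X
  set N := l2norm (X *ᵥ (θ - θ₀))
  set t := √ρ * √(s * Real.log p)
  have ht : 0 ≤ t := by positivity
  have hsD : √D ≤ D := Real.sqrt_le_iff.2 ⟨by linarith, by nlinarith⟩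
  have hsD' : √D * √D = D := Real.mul_self_sqrt (by linarith)
  have hρ' : √ρ * √ρ = ρ := Real.mul_self_sqrt (by linarith)
  have hs' : √s * √s = s := Real.mul_self_sqrt hs
  have hr1 : √392 * √D * t / (ψ * φ) ≤ √392 * D * t / (ψ * φ) := by gcongr
  refine ⟨?_, ?_, ?_⟩
  · calc N < √392 * √D * t / (ψ * φ) := hN
      _ ≤ √392 * D * t / (ψ * φ) := hr1
      _ = _ := by rw [hM]; field_simp; rfl
  · have h1 : √(inflatedDim X lam A₄ ρ (supp θ₀)) ≤ √D * √ρ * √s / φ := by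
      rw [Real.sqrt_le_left (by positivity)]
      refine hdim.trans_eq ?_
      rw [div_pow, mul_pow, mul_pow, Real.sq_sqrt (by linarith), Real.sq_sqrt (by linarith),
        Real.sq_sqrt hs]
    calc _ ≤ _ := hl1
      _ ≤ √392 * √D * t / (ψ * φ) * (√D * √ρ * √s / φ) / (c * ψ) := by gcongr
      _ = √392 * (√D * √D) * (√ρ * √ρ) * (√s * √s) * √(Real.log p) / (ψ ^ 2 * c * φ ^ 2) := by
        simp only [t]
        rw [Real.sqrt_mul hs]; field_simp
      _ = _ := by rw [hsD', hρ', hs', hM]; field_simp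
  · calc _ ≤ _ := hl2
      _ ≤ √392 * D * t / (ψ * φ) / (c * ψt) := by gcongr; exact hN.le.trans hr1
      _ ≤ √392 * D * t / (ψt * φ) / (c * ψt) := by gcongr
      _ = _ := by rw [hM]; field_simp; rfl

/-- On the noise event, parameters of low dimension with a large prediction error have an
exponentially small likelihood ratio. -/
lemma Regular.excess_le (hr : Regular X lam A₄ ρ θ₀) (h : PriorCond A₁ A₂ A₃ A₄ X w lam)
    (hA₄ : 0 < A₄) {D : ℝ} (hD : D = 2 + 132 / A₄) {θ : Fin p → ℝ}
    (hdim : (supp θ).card < dimBound X lam A₄ ρ (supp θ₀))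
    (hN : radius X lam A₄ ρ D (supp θ₀) ≤ l2norm (X *ᵥ (θ - θ₀)))
    {Y : Fin n → ℝ} (hY : Y ∈ noiseEvent X θ₀ (lamBar X)) :
    excess X lam θ₀ Y θ ≤ -(ρ * ((supp θ₀).card * Real.log p)) +
      (lam * l1norm θ - lam / 4 * l1norm (θ - θ₀)) := by
  have hψ := hr.psiBar_pos h hA₄
  have hψ1 := hr.psiBar_le_one h hA₄
  have hφ := hr.compat_pos
  have hφ1 := compat_le_one h.colNorm_pos hr.supp_nonempty
  have hX := h.colNorm_pos
  have hρ := hr.one_le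
  have hlog := hr.one_le_log
  have hd := hr.inflatedDim_le h hA₄
  rw [← hD] at hd
  have hquad := l1norm_le_quadratic hX hψ (hr.card_supp_sub_le hdim) h.lamBar_pos.le
  change _ ≤ _ + 49 / 4 * (_ / (_ * psiBar X lam A₄ ρ (supp θ₀) ^ 2)) at hquad
  have hdot := dotProduct_mulVec_le hY (θ - θ₀)
  have htri := mul_le_mul_of_nonneg_left (l1norm_sub_l1norm_le θ₀ θ) h.lam_pos.le
  have hup := mul_le_mul_of_nonneg_right h.lam_upper (l1norm_nonneg (θ - θ₀))
  have hD2 : 2 ≤ D := by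
    have : 0 ≤ 132 / A₄ := by positivity
    linarith
  have hL0 : 0 ≤ (supp θ₀).card * Real.log p := by
    have := hr.one_le_card
    positivity
  have hlb : lamBar X ^ 2 = 4 * colNorm X ^ 2 * Real.log p := by
    rw [lamBar, mul_pow, mul_pow, Real.sq_sqrt (by linarith)]; ring
  have hr2 : radius X lam A₄ ρ D (supp θ₀) ^ 2 =
      392 * (D * ρ * ((supp θ₀).card * Real.log p) /
        (psiBar X lam A₄ ρ (supp θ₀) ^ 2 * compat X (supp θ₀) ^ 2)) := by
    rw [radius, div_pow, mul_pow, mul_pow, mul_pow, mul_pow, Real.sq_sqrt (by norm_num),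
      Real.sq_sqrt (by linarith), Real.sq_sqrt (by linarith), Real.sq_sqrt hL0]
    ring
  have hr0 : 0 ≤ radius X lam A₄ ρ D (supp θ₀) := by unfold radius; positivity
  have hN2 := pow_le_pow_left₀ hr0 hN 2
  rw [hr2] at hN2
  rw [hlb] at hquad
  set ψ := psiBar X lam A₄ ρ (supp θ₀)
  set φ := compat X (supp θ₀)
  set c := colNorm X
  set N := l2norm (X *ᵥ (θ - θ₀))
  set d := inflatedDim X lam A₄ ρ (supp θ₀)
  set L := (supp θ₀).card * Real.log p
  set B := D * ρ * L / (ψ ^ 2 * φ ^ 2)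
  have hdB : 4 * c ^ 2 * Real.log p * d / (c ^ 2 * ψ ^ 2) ≤ 4 * B := by
    calc 4 * c ^ 2 * Real.log p * d / (c ^ 2 * ψ ^ 2)
        ≤ 4 * c ^ 2 * Real.log p * (D * ρ * (supp θ₀).card / φ ^ 2) / (c ^ 2 * ψ ^ 2) := by
          gcongr
      _ = 4 * B := by simp only [B, L]; field_simp
  have hB : ρ * L ≤ B := by
    rw [le_div_iff₀ (by positivity)]
    have h1 : ψ ^ 2 * φ ^ 2 ≤ 1 :=
      mul_le_one₀ (pow_le_one₀ hψ.le hψ1) (by positivity) (pow_le_one₀ hφ.le hφ1)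
    have h2 : 0 ≤ ρ * L := by positivity
    nlinarith
  have hB0 : 0 ≤ ρ * L := by positivity
  rw [excess]
  linarith

end Regular

variable {ρ : ℝ} {θ₀ : Fin p → ℝ}

/-! ### Nonasymptotic bounds for a fixed design -/

/-- The event on which the noise is small, the normalizing integral is not too large, and large
models have an exponentially small numerator. -/
def goodEvent (X : Matrix (Fin n) (Fin p) ℝ) (w : ℕ → ℝ) (lam A₄ ρ : ℝ) (θ₀ : Fin p → ℝ) :
    Set (Fin n → ℝ) :=
  {Y | Y ∈ noiseEvent X θ₀ (lamBar X) ∧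
    numer X w lam θ₀ 0 Y ≤ ENNReal.ofReal
      (Real.exp ((slack X lam (supp θ₀) + 1) * ((supp θ₀).card * Real.log p))) ∧
    numer X w lam θ₀ (dimBound X lam A₄ ρ (supp θ₀)) Y ≤ ENNReal.ofReal
      (Real.exp (-(ρ * ((supp θ₀).card * Real.log p))))}

lemma measurableSet_goodEvent (h : PriorCond A₁ A₂ A₃ A₄ X w lam) :
    MeasurableSet (goodEvent X w lam A₄ ρ θ₀) := by
  have := isProbabilityMeasure_prior h
  exact (measurableSet_noiseEvent X θ₀ _).inter
    ((measurableSet_le (measurable_numer θ₀ 0) measurable_const).inter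
      (measurableSet_le (measurable_numer θ₀ _) measurable_const))

lemma dataLaw_compl_goodEvent_le (h : PriorCond A₁ A₂ A₃ A₄ X w lam) (hA₂ : 0 < A₂) (hA₄ : 0 < A₄)
    (hq : 4 * (A₂ * (p : ℝ) ^ (-A₄)) ≤ 1 / 2)
    (hq' : 4 * (A₂ * (p : ℝ) ^ (-A₄)) ≤ (p : ℝ) ^ (-(A₄ / 2)))
    (hr : Regular X lam A₄ ρ θ₀) :
    dataLaw X θ₀ (goodEvent X w lam A₄ ρ θ₀)ᶜ ≤ ENNReal.ofReal (6 / p) := by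
  have := isProbabilityMeasure_prior h
  have hlog := hr.one_le_log
  have hp0 : (0 : ℝ) < p := by
    by_contra hcon
    have : (p : ℝ) = 0 := le_antisymm (not_lt.1 hcon) (Nat.cast_nonneg p)
    rw [this, Real.log_zero] at hlog
    linarith
  have hp2 : 2 ≤ p := by
    have h1 := Real.log_le_sub_one_of_pos hp0
    exact_mod_cast (by linarith : (2 : ℝ) ≤ p)
  have hs := hr.one_le_card
  have hρ := hr.one_le
  have hK := slack_nonneg h (supp θ₀)
  have hφ := hr.compat_pos
  have hX := h.colNorm_pos
  have hlb := h.lamBar_pos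
  set S := supp θ₀
  set L := S.card * Real.log p with hL
  set K := slack X lam S with hKdef
  set R := dimBound X lam A₄ ρ S
  have hLlog : Real.log p ≤ L := le_mul_of_one_le_left (by linarith) hs
  have hexpo : 49 / 16 * (lam * lamBar X * S.card / (colNorm X ^ 2 * compat X S ^ 2)) ≤ K * L := by
    have e : lam * lamBar X = lam / lamBar X * (4 * colNorm X ^ 2 * Real.log p) := by
      have : lamBar X ^ 2 = 4 * colNorm X ^ 2 * Real.log p := by
        rw [lamBar, mul_pow, mul_pow, Real.sq_sqrt (by linarith)]; ring
      rw [← this]; field_simp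
    have e2 : 49 / 16 * (lam * lamBar X * S.card / (colNorm X ^ 2 * compat X S ^ 2)) =
        49 / 64 * (K * L) := by
      rw [e, hKdef, slack, hL]; field_simp; ring
    rw [e2]
    have : 0 ≤ K * L := mul_nonneg hK (by linarith)
    linarith
  have hexp := Real.exp_le_exp.2 hexpo
  have hpL : Real.exp (-L) ≤ 1 / p := by
    rw [Real.exp_neg, ← one_div]
    refine one_div_le_one_div_of_le hp0 ?_
    rw [← Real.exp_log hp0]
    exact Real.exp_le_exp.2 hLlog
  -- the normalizing integral
  have b1 : dataLaw X θ₀ (noiseEvent X θ₀ (lamBar X) ∩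
      {Y | ENNReal.ofReal (Real.exp ((K + 1) * L)) < numer X w lam θ₀ 0 Y}) ≤
        ENNReal.ofReal (2 / p) := by
    refine (measure_inter_lt_le _ (measurable_numer θ₀ 0) (Real.exp_pos _)
      (lintegral_numer_le h hA₂ hq hφ 0)).trans (ENNReal.ofReal_le_ofReal ?_)
    rw [pow_zero, mul_one, div_le_iff₀ (Real.exp_pos _)]
    calc _ ≤ Real.exp (K * L) * 2 := by gcongr
      _ = 2 * Real.exp (-L) * Real.exp ((K + 1) * L) := by
        rw [mul_assoc, ← Real.exp_add]; ring_nf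
      _ ≤ 2 * (1 / p) * Real.exp ((K + 1) * L) := by gcongr
      _ = _ := by ring
  -- the numerator of large models
  have hpow : (4 * (A₂ * (p : ℝ) ^ (-A₄))) ^ R ≤ Real.exp (-(2 * ρ * (1 + K) * L)) := by
    refine (pow_le_pow_left₀ (by positivity) hq' R).trans ?_
    rw [Real.rpow_def_of_pos hp0, ← Real.exp_nat_mul]
    refine Real.exp_le_exp.2 ?_
    have h1 : 4 * ρ / A₄ * (1 + K) * S.card ≤ R := Nat.le_ceil _
    have h2 : 0 ≤ Real.log p * (A₄ / 2) := by positivity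
    have h3 := mul_le_mul_of_nonneg_right h1 h2
    -- half of the exponent `A₄` absorbs the constant `4 * A₂`, and the other half remains
    have h4 : 4 * ρ / A₄ * (1 + K) * S.card * (Real.log p * (A₄ / 2)) = 2 * ρ * (1 + K) * L := by
      rw [hL]; field_simp; ring
    linarith
  have b2 : dataLaw X θ₀ (noiseEvent X θ₀ (lamBar X) ∩
      {Y | ENNReal.ofReal (Real.exp (-(ρ * L))) < numer X w lam θ₀ R Y}) ≤
        ENNReal.ofReal (2 / p) := by
    refine (measure_inter_lt_le _ (measurable_numer θ₀ R) (Real.exp_pos _)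
      (lintegral_numer_le h hA₂ hq hφ R)).trans (ENNReal.ofReal_le_ofReal ?_)
    rw [div_le_iff₀ (Real.exp_pos _)]
    have h1 : K * L + -(2 * ρ * (1 + K) * L) ≤ -L + -(ρ * L) := by
      have h2 : 0 ≤ (ρ - 1) * L := mul_nonneg (by linarith) (by linarith)
      have h3 : 0 ≤ K * L := mul_nonneg hK (by linarith)
      have h4 : 0 ≤ K * L * (ρ - 1) := mul_nonneg h3 (by linarith)
      nlinarith
    calc _ ≤ Real.exp (K * L) * (2 * Real.exp (-(2 * ρ * (1 + K) * L))) := by gcongr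
      _ = 2 * Real.exp (K * L + -(2 * ρ * (1 + K) * L)) := by rw [Real.exp_add]; ring
      _ ≤ 2 * Real.exp (-L + -(ρ * L)) := by gcongr
      _ = 2 * Real.exp (-L) * Real.exp (-(ρ * L)) := by rw [Real.exp_add]; ring
      _ ≤ 2 * (1 / p) * Real.exp (-(ρ * L)) := by gcongr
      _ = _ := by ring
  have hsub : (goodEvent X w lam A₄ ρ θ₀)ᶜ ⊆ (noiseEvent X θ₀ (lamBar X))ᶜ ∪
      ((noiseEvent X θ₀ (lamBar X) ∩
        {Y | ENNReal.ofReal (Real.exp ((K + 1) * L)) < numer X w lam θ₀ 0 Y}) ∪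
      (noiseEvent X θ₀ (lamBar X) ∩
        {Y | ENNReal.ofReal (Real.exp (-(ρ * L))) < numer X w lam θ₀ R Y})) := by
    intro Y hY
    by_contra hcon
    simp only [Set.mem_union, Set.mem_compl_iff, Set.mem_inter_iff, Set.mem_ofPred_eq, not_or,
      not_not, not_and, not_lt] at hcon
    exact hY ⟨hcon.1, hcon.2.1 hcon.1, hcon.2.2 hcon.1⟩
  refine (measure_mono hsub).trans ((measure_union_le _ _).trans ?_)
  refine (add_le_add (dataLaw_compl_noiseEvent_le hp2 hX θ₀) ((measure_union_le _ _).trans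
    (add_le_add b1 b2))).trans_eq ?_
  rw [← ENNReal.ofReal_add (by positivity) (by positivity),
    ← ENNReal.ofReal_add (by positivity) (by positivity)]
  congr 1; ring

/-- On the good event, the numerator of the posterior mass of the bad set is exponentially small. -/
lemma lintegral_badSet_le (h : PriorCond A₁ A₂ A₃ A₄ X w lam) (hA₂ : 0 < A₂) (hA₄ : 0 < A₄)
    (hq : 4 * (A₂ * (p : ℝ) ^ (-A₄)) ≤ 1 / 2) (hr : Regular X lam A₄ ρ θ₀)
    {Y : Fin n → ℝ} (hY : Y ∈ goodEvent X w lam A₄ ρ θ₀) :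
    ∫⁻ θ in badSet X lam A₄ ρ (2 + 132 / A₄) θ₀, ENNReal.ofReal (Real.exp (excess X lam θ₀ Y θ))
        ∂(prior p w lam) ≤
      ENNReal.ofReal (3 * Real.exp (-(ρ * ((supp θ₀).card * Real.log p)))) := by
  obtain ⟨hT, -, hR⟩ := hY
  set e := Real.exp (-(ρ * ((supp θ₀).card * Real.log p)))
  set R := dimBound X lam A₄ ρ (supp θ₀)
  have hE : badSet X lam A₄ ρ (2 + 132 / A₄) θ₀ = {θ | R ≤ (supp θ).card} ∪
      ({θ | radius X lam A₄ ρ (2 + 132 / A₄) (supp θ₀) ≤ l2norm (X *ᵥ (θ - θ₀))} \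
        {θ | R ≤ (supp θ).card}) := by
    rw [Set.union_sdiff_self]; rfl
  have hmeas := (measurableSet_le measurable_const (measurable_predictionError X θ₀)).diff
    (measurableSet_le_card_supp (p := p) R) (s₁ := {θ | radius X lam A₄ ρ (2 + 132 / A₄) (supp θ₀) ≤
      l2norm (X *ᵥ (θ - θ₀))})
  have h2 : ∫⁻ θ in ({θ | radius X lam A₄ ρ (2 + 132 / A₄) (supp θ₀) ≤
      l2norm (X *ᵥ (θ - θ₀))} \ {θ | R ≤ (supp θ).card}),
        ENNReal.ofReal (Real.exp (excess X lam θ₀ Y θ)) ∂(prior p w lam) ≤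
      ENNReal.ofReal e * ENNReal.ofReal 2 := by
    have h3 := lintegral_prior_le h hA₂ hq θ₀ 0
    rw [pow_zero, mul_one] at h3
    calc _ ≤ ∫⁻ θ in ({θ | radius X lam A₄ ρ (2 + 132 / A₄) (supp θ₀) ≤
            l2norm (X *ᵥ (θ - θ₀))} \ {θ | R ≤ (supp θ).card}), ENNReal.ofReal e *
          ENNReal.ofReal (Real.exp (lam * l1norm θ - lam / 4 * l1norm (θ - θ₀)))
            ∂(prior p w lam) := by
          refine setLIntegral_mono' hmeas fun θ hθ => ?_
          rw [← ENNReal.ofReal_mul (Real.exp_pos _).le, ← Real.exp_add]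
          exact ENNReal.ofReal_le_ofReal (Real.exp_le_exp.2
            (hr.excess_le h hA₄ rfl (not_le.1 hθ.2) hθ.1 hT))
      _ ≤ _ := by
          rw [lintegral_const_mul' _ _ (by simp)]
          refine mul_le_mul_right (le_trans ?_ h3) _
          simp only [zero_le, Set.ofPred_true, Measure.restrict_univ]
          exact setLIntegral_le_lintegral _ _
  rw [hE]
  refine (lintegral_union_le _ _ _).trans ((add_le_add hR h2).trans_eq ?_)
  have he : 0 < e := Real.exp_pos _
  rw [← ENNReal.ofReal_mul he.le, ← ENNReal.ofReal_add he.le (by positivity)]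
  congr 1; ring

/-- On the good event, a variational posterior gives little mass to the bad set, because its
divergence from the posterior is at most that of the competitor `oracle`. -/
lemma variational_badSet_le (h : PriorCond A₁ A₂ A₃ A₄ X w lam) (hA₁ : 0 < A₁) (hA₂ : 0 < A₂)
    (hA₃ : 0 < A₃) (hA₄ : 0 < A₄) (hq : 4 * (A₂ * (p : ℝ) ^ (-A₄)) ≤ 1 / 2)
    (hr : Regular X lam A₄ ρ θ₀) {c₀ : ℝ} (hc₀ : 0 < c₀) (hc : c₀ ≤ compat X (supp θ₀))
    (hρ : 8 + |Real.log A₁| + A₃ + 2 < ρ) {F : Set (Measure (Fin p → ℝ))}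
    (hF : ∀ σ : ℝ≥0, 0 < σ → oracle θ₀ σ ∈ F)
    {Y : Fin n → ℝ} {Q : Measure (Fin p → ℝ)} [IsProbabilityMeasure Q]
    (hQ : IsVB F (posterior X w lam Y) Q) (hY : Y ∈ goodEvent X w lam A₄ ρ θ₀) :
    Q.real (badSet X lam A₄ ρ (2 + 132 / A₄) θ₀) ≤
      (8 + |Real.log A₁| + A₃ + 32 / c₀ ^ 2 + 2) / (ρ - (8 + |Real.log A₁| + A₃ + 2)) := by
  have := isProbabilityMeasure_prior h
  have := isProbabilityMeasure_posterior (X := X) w lam Y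
  have hnum := lintegral_badSet_le h hA₂ hA₄ hq hr hY
  obtain ⟨-, hI, -⟩ := hY
  rw [numer_zero, ENNReal.ofReal_le_ofReal_iff (Real.exp_pos _).le] at hI
  have hIpos := integral_exp_pos (integrable_exp_excess (X := X) (prior p w lam) lam θ₀ Y)
  have hlog := hr.one_le_log
  have hs := hr.one_le_card
  have hX := h.colNorm_pos
  obtain ⟨σ, hσe⟩ : ∃ σ : ℝ≥0, (σ : ℝ) = (colNorm X)⁻¹ :=
    ⟨NNReal.mk _ (inv_pos.2 hX).le, rfl⟩
  have hσ : 0 < σ := by rw [← NNReal.coe_pos, hσe]; exact inv_pos.2 hX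
  have hw0 : 1 / 2 ≤ w 0 := by
    refine h.half_le_weight_zero hA₂ ?_
    have : 0 ≤ A₂ * (p : ℝ) ^ (-A₄) := by positivity
    linarith
  have hcard : (supp θ₀).card ≤ p := by simpa using (supp θ₀).card_le_univ
  obtain ⟨hw, hb⟩ := oracle_bound h hA₁ hlog hw0
    (Finset.card_pos.2 hr.supp_nonempty) hcard hσe
  obtain ⟨h0, hKL⟩ := klDiv_oracle_posterior_le h θ₀ hσ hw hb Y
  set C := 8 + |Real.log A₁| + A₃
  have hC : 0 ≤ C := by positivity
  set L := (supp θ₀).card * Real.log p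
  have hL : 1 ≤ L := one_le_mul_of_one_le_of_one_le hs hlog
  set I := ∫ θ, Real.exp (excess X lam θ₀ Y θ) ∂(prior p w lam)
  set K := slack X lam (supp θ₀)
  have hlogI : Real.log I ≤ (K + 1) * L := by
    rw [← Real.log_exp ((K + 1) * L)]; exact Real.log_le_log hIpos hI
  have hE := measurableSet_badSet (X := X) lam A₄ ρ (2 + 132 / A₄) θ₀
  have hpost : posterior X w lam Y (badSet X lam A₄ ρ (2 + 132 / A₄) θ₀) ≤
      ENNReal.ofReal (Real.exp (-((ρ - (C + 2)) * L))) := by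
    rw [posterior_apply w lam θ₀ Y hE]
    refine (ENNReal.div_le_div_right hnum _).trans ?_
    rw [← ENNReal.ofReal_div_of_pos hIpos]
    refine ENNReal.ofReal_le_ofReal ?_
    rw [div_le_iff₀ hIpos]
    have h1 : Real.exp (-(C * L)) ≤ I := by
      rw [← Real.exp_log hIpos]; exact Real.exp_le_exp.2 (by linarith)
    -- the factor `3` from the numerator is absorbed in the exponent
    have h3 : 3 ≤ Real.exp (2 * L) := by
      have := Real.add_one_le_exp (2 * L); linarith
    calc 3 * Real.exp (-(ρ * L)) ≤ Real.exp (2 * L) * Real.exp (-(ρ * L)) := by gcongr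
      _ = Real.exp (-((ρ - (C + 2)) * L)) * Real.exp (-(C * L)) := by
        rw [← Real.exp_add, ← Real.exp_add]; ring_nf
      _ ≤ _ := by gcongr
  have hDV := measureReal_mul_le_of_klDiv_le h0 ((hQ.2 _ (hF _ hσ)).trans hKL) hE hpost
  have hK : K ≤ 32 / c₀ ^ 2 := by
    refine (slack_le h (supp θ₀)).trans ?_
    gcongr
  have h2 : Real.log 2 ≤ L := by have := Real.log_two_lt_d9; linarith
  rw [le_div_iff₀ (by linarith)]
  set q := Q.real (badSet X lam A₄ ρ (2 + 132 / A₄) θ₀)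
  have h4 : K * L ≤ 32 / c₀ ^ 2 * L := by gcongr
  have h5 : q * (ρ - (C + 2)) * L ≤ (C + 32 / c₀ ^ 2 + 2) * L := by linarith
  exact le_of_mul_le_mul_right h5 (by linarith)

/-- The expected mass that a variational posterior gives to a subset of the bad set. -/
lemma upperExp_variational_le (h : PriorCond A₁ A₂ A₃ A₄ X w lam) (hA₁ : 0 < A₁) (hA₂ : 0 < A₂)
    (hA₃ : 0 < A₃) (hA₄ : 0 < A₄) (hq : 4 * (A₂ * (p : ℝ) ^ (-A₄)) ≤ 1 / 2)
    (hq' : 4 * (A₂ * (p : ℝ) ^ (-A₄)) ≤ (p : ℝ) ^ (-(A₄ / 2)))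
    (hr : Regular X lam A₄ ρ θ₀) {c₀ : ℝ} (hc₀ : 0 < c₀) (hc : c₀ ≤ compat X (supp θ₀))
    (hρ : 8 + |Real.log A₁| + A₃ + 2 < ρ) {F : Set (Measure (Fin p → ℝ))}
    (hprob : ∀ Q ∈ F, IsProbabilityMeasure Q) (hF : ∀ σ : ℝ≥0, 0 < σ → oracle θ₀ σ ∈ F)
    {Q : (Fin n → ℝ) → Measure (Fin p → ℝ)} (hQ : ∀ Y, IsVB F (posterior X w lam Y) (Q Y))
    {B : Set (Fin p → ℝ)} (hB : B ⊆ badSet X lam A₄ ρ (2 + 132 / A₄) θ₀) :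
    upperExp (dataLaw X θ₀) (fun Y => Q Y B) ≤
      ENNReal.ofReal ((8 + |Real.log A₁| + A₃ + 32 / c₀ ^ 2 + 2) /
        (ρ - (8 + |Real.log A₁| + A₃ + 2))) + ENNReal.ofReal (6 / p) := by
  set bnd := (8 + |Real.log A₁| + A₃ + 32 / c₀ ^ 2 + 2) / (ρ - (8 + |Real.log A₁| + A₃ + 2))
  have hG := measurableSet_goodEvent (ρ := ρ) (θ₀ := θ₀) h
  have hind : Measurable ((goodEvent X w lam A₄ ρ θ₀)ᶜ.indicator fun _ => (1 : ℝ≥0∞)) :=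
    measurable_const.indicator hG.compl
  refine iInf_le_of_le (fun Y => ENNReal.ofReal bnd +
    (goodEvent X w lam A₄ ρ θ₀)ᶜ.indicator (fun _ => 1) Y) (iInf_le_of_le
      (hind.const_add _) (iInf_le_of_le (fun Y => ?_) ?_))
  · have := hprob _ (hQ Y).1
    by_cases hY : Y ∈ goodEvent X w lam A₄ ρ θ₀
    · refine le_add_right ((measure_mono hB).trans ?_)
      rw [← ofReal_measureReal]
      exact ENNReal.ofReal_le_ofReal
        (variational_badSet_le h hA₁ hA₂ hA₃ hA₄ hq hr hc₀ hc hρ hF (hQ Y) hY)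
    · change Q Y B ≤ _ + _
      rw [Set.indicator_of_mem (show Y ∈ (goodEvent X w lam A₄ ρ θ₀)ᶜ from hY)]
      exact le_add_left prob_le_one
  · rw [lintegral_add_left measurable_const, lintegral_indicator_const hG.compl]
    simp only [lintegral_const, measure_univ, mul_one, one_mul]
    gcongr
    exact dataLaw_compl_goodEvent_le h hA₂ hA₄ hq hq' hr

/-! ### The variational families and the limit -/

lemma isProbabilityMeasure_of_mem_familyPMF {Q : Measure (Fin p → ℝ)} (hQ : Q ∈ familyPMF p) :
    IsProbabilityMeasure Q := by
  obtain ⟨μ, σ, γ, -, hγ, rfl⟩ := hQ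
  have : ∀ i, IsProbabilityMeasure (ENNReal.ofReal (γ i) • gaussianReal (μ i) (σ i ^ 2) +
      ENNReal.ofReal (1 - γ i) • Measure.dirac (0 : ℝ)) := fun i => by
    refine ⟨?_⟩
    have h1 : 0 ≤ 1 - γ i := by linarith [(hγ i).2]
    simp [← ENNReal.ofReal_add (hγ i).1 h1]
  infer_instance

lemma isProbabilityMeasure_of_mem_familyQ {Q : Measure (Fin p → ℝ)} (hQ : Q ∈ familyQ p) :
    IsProbabilityMeasure Q := by
  obtain ⟨S, μ, Sig, -, rfl⟩ := hQ
  exact Measure.isProbabilityMeasure_map (measurable_extendZero S).aemeasurable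

lemma familyQMF_subset : familyQMF p ⊆ familyQ p := by
  rintro Q ⟨S, μ, D, h1, -, h3⟩
  exact ⟨S, μ, D, h1, h3⟩

lemma recovers_of_oracle_mem {n p : ℕ → ℕ} {X : ∀ k, Matrix (Fin (n k)) (Fin (p k)) ℝ}
    {w : ℕ → ℕ → ℝ} {lam : ℕ → ℝ} {s : ℕ → ℕ} {ρ : ℕ → ℝ} {c₀ : ℝ} (hA₁ : 0 < A₁) (hA₂ : 0 < A₂)
    (hA₃ : 0 < A₃) (hA₄ : 0 < A₄) (hp : Tendsto p atTop atTop)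
    (h : ∀ k, PriorCond A₁ A₂ A₃ A₄ (X k) (w k) (lam k)) (hρ : Tendsto ρ atTop atTop)
    (hc₀ : 0 < c₀) {F : ∀ k, Set (Measure (Fin (p k) → ℝ))}
    (hprob : ∀ k, ∀ Q ∈ F k, IsProbabilityMeasure Q)
    (hF : ∀ k θ₀ (σ : ℝ≥0), 0 < σ → oracle θ₀ σ ∈ F k)
    {Q : ∀ k, (Fin (n k) → ℝ) → Measure (Fin (p k) → ℝ)}
    (hQ : ∀ k Y, IsVB (F k) (posterior (X k) (w k) (lam k) Y) (Q k Y)) :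
    Recovers X lam A₄ c₀ ρ s (√392 * (2 + 132 / A₄)) Q := by
  set C := 8 + |Real.log A₁| + A₃
  have hpR : Tendsto (fun k => (p k : ℝ)) atTop atTop := tendsto_natCast_atTop_atTop.comp hp
  have hlim : Tendsto (fun k => ENNReal.ofReal ((C + 32 / c₀ ^ 2 + 2) / (ρ k - (C + 2))) +
      ENNReal.ofReal (6 / p k)) atTop (𝓝 0) := by
    have h1 : Tendsto (fun k => (C + 32 / c₀ ^ 2 + 2) / (ρ k - (C + 2))) atTop (𝓝 0) :=
      (tendsto_atTop_add_const_right _ (-(C + 2)) hρ).const_div_atTop _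
    have h2 : Tendsto (fun k => 6 / (p k : ℝ)) atTop (𝓝 0) := hpR.const_div_atTop _
    simpa using (ENNReal.tendsto_ofReal h1).add (ENNReal.tendsto_ofReal h2)
  have hev1 : ∀ᶠ k in atTop, 1 ≤ Real.log (p k) :=
    (Real.tendsto_log_atTop.comp hpR).eventually_ge_atTop 1
  have hev2 : ∀ᶠ k in atTop, 4 * (A₂ * (p k : ℝ) ^ (-A₄)) ≤ 1 / 2 := by
    have h1 := ((tendsto_rpow_neg_atTop hA₄).comp hpR).const_mul (4 * A₂)
    rw [mul_zero] at h1
    filter_upwards [h1.eventually_le_const (by norm_num : (0 : ℝ) < 1 / 2)] with k hk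
    simpa [mul_assoc] using hk
  have hev3 : ∀ᶠ k in atTop, 4 * (A₂ * (p k : ℝ) ^ (-A₄)) ≤ (p k : ℝ) ^ (-(A₄ / 2)) := by
    have h1 := ((tendsto_rpow_neg_atTop (half_pos hA₄)).comp hpR).const_mul (4 * A₂)
    rw [mul_zero] at h1
    filter_upwards [h1.eventually_le_const zero_lt_one, hpR.eventually_gt_atTop 0] with k hk hk0
    have e : (p k : ℝ) ^ (-A₄) = (p k : ℝ) ^ (-(A₄ / 2)) * (p k : ℝ) ^ (-(A₄ / 2)) := by
      rw [← Real.rpow_add hk0]; ring_nf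
    have h2 : 0 ≤ (p k : ℝ) ^ (-(A₄ / 2)) := by positivity
    simp only [Function.comp_apply] at hk
    rw [e]
    nlinarith
  have hev4 := hρ.eventually_gt_atTop (C + 2)
  have hC : 0 ≤ C := by positivity
  have key : ∀ B : ∀ k, (Fin (p k) → ℝ) → Set (Fin (p k) → ℝ),
      (∀ k θ₀, Regular (X k) (lam k) A₄ (ρ k) θ₀ →
        B k θ₀ ⊆ badSet (X k) (lam k) A₄ (ρ k) (2 + 132 / A₄) θ₀) →
      Tendsto (fun k => worstMass (X k) (compatSparse (X k) (lam k) A₄ c₀ (ρ k) (s k)) (Q k)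
        (B k)) atTop (𝓝 0) := fun B hB => by
    refine tendsto_of_tendsto_of_tendsto_of_le_of_le' tendsto_const_nhds hlim
      (Eventually.of_forall fun _ => zero_le) ?_
    filter_upwards [hev1, hev2, hev3, hev4] with k h1 h2 h3 h4
    refine iSup₂_le fun θ₀ hθ₀ => ?_
    obtain ⟨hne, hcompat, -, hψ⟩ := hθ₀
    have hr : Regular (X k) (lam k) A₄ (ρ k) θ₀ :=
      ⟨hne, hc₀.trans_le hcompat, hc₀.trans_le hψ, by linarith, h1⟩
    exact upperExp_variational_le (h k) hA₁ hA₂ hA₃ hA₄ h2 h3 hr hc₀ hcompat h4 (hprob k)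
      (hF k θ₀) (hQ k) (hB k θ₀ hr)
  refine ⟨key _ fun k θ₀ hr θ hθ => ?_, key _ fun k θ₀ hr θ hθ => ?_, key _ fun k θ₀ hr θ hθ => ?_⟩
  · by_contra hcon
    exact absurd hθ (not_le.2 (hr.losses_le (h k) hA₄ rfl rfl hcon).1)
  · by_contra hcon
    exact absurd hθ (not_lt.2 (hr.losses_le (h k) hA₄ rfl rfl hcon).2.1)
  · by_contra hcon
    exact absurd hθ (not_lt.2 (hr.losses_le (h k) hA₄ rfl rfl hcon).2.2)

end SparseVB

theorem theorem1 (A₁ A₂ A₃ A₄ : ℝ) (hA₁ : 0 < A₁) (hA₂ : 0 < A₂) (hA₃ : 0 < A₃) (hA₄ : 0 < A₄) :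
    ∃ M : ℝ, 0 < M ∧
      ∀ (n p : ℕ → ℕ) (X : ∀ k, Matrix (Fin (n k)) (Fin (p k)) ℝ)
        (w : ℕ → ℕ → ℝ) (lam : ℕ → ℝ) (s : ℕ → ℕ) (ρ : ℕ → ℝ) (c₀ : ℝ),
        Tendsto p atTop atTop →
        (∀ k, SparseVB.PriorCond A₁ A₂ A₃ A₄ (X k) (w k) (lam k)) →
        (∀ k, 1 ≤ s k) →
        (lam =O[atTop] fun k => SparseVB.colNorm (X k) * √(Real.log (p k)) / (s k : ℝ)) →
        Tendsto ρ atTop atTop →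
        0 < c₀ →
        (∀ Q : ∀ k, (Fin (n k) → ℝ) → Measure (Fin (p k) → ℝ),
          (∀ k Y, SparseVB.IsVB (SparseVB.familyPMF (p k))
            (SparseVB.posterior (X k) (w k) (lam k) Y) (Q k Y)) →
          SparseVB.Recovers X lam A₄ c₀ ρ s M Q) ∧
        (∀ Q : ∀ k, (Fin (n k) → ℝ) → Measure (Fin (p k) → ℝ),
          (∀ k Y, SparseVB.IsVB (SparseVB.familyQ (p k))
            (SparseVB.posterior (X k) (w k) (lam k) Y) (Q k Y)) →
          SparseVB.Recovers X lam A₄ c₀ ρ s M Q) ∧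
        (∀ Q : ∀ k, (Fin (n k) → ℝ) → Measure (Fin (p k) → ℝ),
          (∀ k Y, SparseVB.IsVB (SparseVB.familyQMF (p k))
            (SparseVB.posterior (X k) (w k) (lam k) Y) (Q k Y)) →
          SparseVB.Recovers X lam A₄ c₀ ρ s M Q) := by
  refine ⟨√392 * (2 + 132 / A₄), by positivity, fun n p X w lam s ρ c₀ hp h _ _ hρ hc₀ =>
    ⟨fun Q hQ => ?_, fun Q hQ => ?_, fun Q hQ => ?_⟩⟩
  · exact SparseVB.recovers_of_oracle_mem hA₁ hA₂ hA₃ hA₄ hp h hρ hc₀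
      (fun _ _ => SparseVB.isProbabilityMeasure_of_mem_familyPMF)
      (fun _ θ₀ _ => SparseVB.oracle_mem_familyPMF θ₀) hQ
  · exact SparseVB.recovers_of_oracle_mem hA₁ hA₂ hA₃ hA₄ hp h hρ hc₀
      (fun _ _ => SparseVB.isProbabilityMeasure_of_mem_familyQ)
      (fun _ θ₀ _ => SparseVB.oracle_mem_familyQ θ₀) hQ
  · exact SparseVB.recovers_of_oracle_mem hA₁ hA₂ hA₃ hA₄ hp h hρ hc₀
      (fun _ _ hQ => SparseVB.isProbabilityMeasure_of_mem_familyQ (SparseVB.familyQMF_subset hQ))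
      (fun _ θ₀ _ => SparseVB.oracle_mem_familyQMF θ₀) hQ
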